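/- Let $\Gamma=\{1,\dots,n\}$ be a set of $n$ parties. A pair access structure $(\mathcal A,\mathcal U)$ consists of two sets of unordered pairs $\{T,T'\}$ of disjoint subsets of $\Gamma$; assume $\mathcal A\cap\mathcal U=\varnothing$. Let $\cup\mathcal A$ be the set of all $T\subseteq\Gamma$ that occur in a pair of $\mathcal A$, and let $G_{\mathcal A}$ be the graph with vertex set $\cup\mathcal A$ and edge set $\mathcal A$. Each party holds a finite (possibly zero) number of qubits. A stabilizer state is the maximally mixed state on the common $+1$ eigenspace of an abelian group of Pauli operators that contains no scalar other than $1$. A Clifford decoder for $T$ is a channel from the qubits of $T$ to one qubit which applies a Clifford unitary to the qubits of $T$ and then traces out all of them but one. Let $\Psi^+$ be the EPR state of two qubits. We say that $(\mathcal A,\mathcal U)$ is realizable by a stabilizer entanglement sharing scheme (ESS) with unknown partner if there are a stabilizer state $\rho$ on the qubits of the parties and a family of Clifford decoders $\{\mathcal N_T\}_{T\in\cup\mathcal A}$ such that: 1. (authorized pairs) $(\mathcal N_T\otimes\mathcal N_{T'})(\rho_{TT'})=\Psi^+$ for all $\{T,T'\}\in\mathcal A$; 2. (unauthorized pairs) there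 is $\delta>0$ such that for every $\{T,T'\}\in\mathcal U$ and every family of channels $\{\mathcal M_R\}$ with single-qubit outputs and $\mathcal M_R=\mathcal N_R$ for all $R\in\cup\mathcal A$, the fidelity of $(\mathcal M_T\otimes\mathcal M_{T'})(\rho_{TT'})$ with $\Psi^+$ is at most $1-\delta$; 3. (maximality) there is no proper superset $\mathcal A'\supsetneq\mathcal A$ consisting of pairs of disjoint subsets, together with a family of channels $\{\mathcal M_T\}_{T\in\cup\mathcal A'}$ with $\mathcal M_T=\mathcal N_T$ for $T\in\cup\mathcal A$, such that $(\mathcal M_T\otimes\mathcal M_{T'})(\rho_{TT'})=\Psi^+$ for all $\{T,T'\}\in\mathcal A'$. Theorem. $(\mathcal A,\mathcal U)$ is realizable by a stabilizer ESS with unknown partner if and only if the following three conditions hold. * No odd cycles: $G_{\mathcal A}$ contains no cycle of odd length. * Transitivity: if $T$ and $T'$ are the endpoints of a path of odd length in $G_{\mathcal A}$ and $T\cap T'=\varnothing$, then $\{T,T'\}\in\mathcal A$. * For each connected component $C$ of $G_{\mathcal A}$ there are vectors $u_{pq}\in\mathbb F_2^{\,n}$, indexed by the pairs of vertices $T_p,T_q$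 of $C$, such that for all vertices $T_p,T_q,T_r,T_s$ of $C$ $$\operatorname{supp}(u_{pq})\subseteq T_p\cap T_q,$$ $$z_0\cdot u_{pq}=\begin{cases}1&\text{if } T_p \text{ and } T_q \text{ lie on the same side of } G_{\mathcal A},\\0&\text{otherwise,}\end{cases}$$ $$z_R\cdot(u_{pq}+u_{ps}+u_{rq}+u_{rs})=0\quad\text{for every } R\subseteq\Gamma \text{ with } R\notin\cup\mathcal A.$$ Here $z_0$ is the all-ones vector, $z_R$ is the indicator vector of $R$, and two vertices of $C$ lie on the same side if they are joined by a walk of even length in $G_{\mathcal A}$ (when there are no odd cycles these are the two sides of the bipartition of $C$). -/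

import Mathlib

open scoped Kronecker

noncomputable section

namespace ESS

/-! ### Pair access structures -/

/-- The flattening of a set of unordered pairs of sets of parties: all sets of parties that occur
in some pair. -/
def flattening {n : ℕ} (𝒜 : Set (Sym2 (Finset (Fin n)))) : Set (Finset (Fin n)) :=
  {T | ∃ T', s(T, T') ∈ 𝒜}

/-- The two members of every pair are disjoint. -/
def PairsDisjoint {n : ℕ} (𝒜 : Set (Sym2 (Finset (Fin n)))) : Prop :=
  ∀ T T' : Finset (Fin n), s(T, T') ∈ 𝒜 → Disjoint T T'

/-- A pair access structure on `n` parties. -/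
structure PairAccessStructure (n : ℕ) where
  authorized : Set (Sym2 (Finset (Fin n)))
  unauthorized : Set (Sym2 (Finset (Fin n)))
  authorized_disjoint : PairsDisjoint authorized
  unauthorized_disjoint : PairsDisjoint unauthorized

/-- The authorized pair graph: vertices are the sets in the flattening, edges are the pairs in `𝒜`.
(Among disjoint pairs the only possible loop is the degenerate pair `{∅, ∅}`; its vertex `∅` is
kept, the loop is not recorded in the graph.) -/
def authGraph {n : ℕ} (𝒜 : Set (Sym2 (Finset (Fin n)))) : SimpleGraph (flattening 𝒜) where
  Adj p q := p ≠ q ∧ s(p.1, q.1) ∈ 𝒜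
  symm := ⟨fun _ _ h => ⟨h.1.symm, Sym2.eq_swap ▸ h.2⟩⟩
  loopless := ⟨fun _ h => h.1 rfl⟩

/-! ### Qubit registers, Pauli operators, stabilizer states

A register with qubit labels `κ` has computational basis `κ → ZMod 2`. -/

/-- Operators on a register of qubits labelled by `κ`. -/
abbrev Op (κ : Type) : Type := Matrix (κ → ZMod 2) (κ → ZMod 2) ℂ

/-- Operators on one qubit. -/
abbrev QubitOp : Type := Matrix (ZMod 2) (ZMod 2) ℂ

/-- The single-qubit operator `X ^ a * Z ^ b`, where `X |j⟩ = |j + 1⟩` and `Z |j⟩ = (-1) ^ j |j⟩`. -/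
def pauliOne (a b : ZMod 2) : QubitOp :=
  Matrix.of fun x y => if x = y + a then (-1 : ℂ) ^ (b * y).val else 0

/-- The Pauli string `⨂ q, X ^ (a q) * Z ^ (b q)`. -/
def pauliString {κ : Type} [Fintype κ] (a b : κ → ZMod 2) : Op κ :=
  Matrix.of fun x y => ∏ q, pauliOne (a q) (b q) (x q) (y q)

/-- Membership in the Pauli group: a Pauli string times a power of `i`. -/
def IsPauli {κ : Type} [Fintype κ] (M : Op κ) : Prop :=
  ∃ (k : ℕ) (a b : κ → ZMod 2), M = Complex.I ^ k • pauliString a b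

/-- A stabilizer group: an abelian group of Pauli operators whose only scalar is the identity. -/
def IsStabilizerGroup {κ : Type} [Fintype κ] [DecidableEq κ]
    (G : Subgroup (Matrix.unitaryGroup (κ → ZMod 2) ℂ)) : Prop :=
  (∀ g ∈ G, IsPauli (g : Op κ)) ∧
  (∀ g ∈ G, ∀ h ∈ G, g * h = h * g) ∧
  (∀ g ∈ G, ∀ c : ℂ, (g : Op κ) = c • (1 : Op κ) → c = 1)

/-- A (possibly mixed) stabilizer state: the maximally mixed state on the common `+1` eigenspace of
a stabilizer group, that is, `P / tr P` for the orthogonal projection `P` onto that eigenspace. -/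
def IsStabilizerState {κ : Type} [Fintype κ] [DecidableEq κ] (ρ : Op κ) : Prop :=
  ∃ G : Subgroup (Matrix.unitaryGroup (κ → ZMod 2) ℂ), IsStabilizerGroup G ∧
    ∃ P : Op κ, P.IsHermitian ∧ P * P = P ∧
      (∀ v : (κ → ZMod 2) → ℂ,
        P.mulVec v = v ↔ ∀ g ∈ G, (g : Op κ).mulVec v = v) ∧
      ρ = P.trace⁻¹ • P

/-- A Clifford unitary: conjugation by it preserves the Pauli group. -/
def IsClifford {κ : Type} [Fintype κ] [DecidableEq κ]
    (U : Matrix.unitaryGroup (κ → ZMod 2) ℂ) : Prop :=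
  ∀ M : Op κ, IsPauli ((U : Op κ) * M * (U : Op κ).conjTranspose) ↔ IsPauli M

/-! ### Channels -/

/-- A quantum channel (completely positive and trace preserving), in operator-sum form. -/
def IsChannel {α β : Type} [Fintype α] [DecidableEq α] [Fintype β]
    (Φ : Matrix α α ℂ →ₗ[ℂ] Matrix β β ℂ) : Prop :=
  ∃ (r : ℕ) (K : Fin r → Matrix β α ℂ),
    (∑ i, (K i).conjTranspose * K i = 1) ∧
    ∀ σ, Φ σ = ∑ i, K i * σ * (K i).conjTranspose

/-- A Clifford decoder: apply a Clifford unitary to the register, then trace out all qubits except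
one output qubit `o`. -/
def IsCliffordDecoder {κ : Type} [Fintype κ] [DecidableEq κ] (Φ : Op κ →ₗ[ℂ] QubitOp) : Prop :=
  ∃ (U : Matrix.unitaryGroup (κ → ZMod 2) ℂ) (o : κ), IsClifford U ∧
    ∀ (σ : Op κ) (a b : ZMod 2), Φ σ a b =
      ∑ x : κ → ZMod 2, if x o = a then
        ((U : Op κ) * σ * (U : Op κ).conjTranspose) x (Function.update x o b) else 0

/-- The value `(Φ ⊗ Ψ) σ` of the tensor product of two linear maps on a bipartite operator `σ`. -/
def tensorApply {α α' β β' : Type} [Fintype α] [DecidableEq α] [Fintype α'] [DecidableEq α']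
    (Φ : Matrix α α ℂ →ₗ[ℂ] Matrix β β ℂ) (Ψ : Matrix α' α' ℂ →ₗ[ℂ] Matrix β' β' ℂ)
    (σ : Matrix (α × α') (α × α') ℂ) : Matrix (β × β') (β × β') ℂ :=
  ∑ x, ∑ y, ∑ x', ∑ y',
    σ (x, x') (y, y') • (Φ (Matrix.single x y 1) ⊗ₖ Ψ (Matrix.single x' y' 1))

/-- The density matrix `|Ψ⁺⟩⟨Ψ⁺|` of the EPR pair `|Ψ⁺⟩ = (|00⟩ + |11⟩) / √2`. -/
def epr : Matrix (ZMod 2 × ZMod 2) (ZMod 2 × ZMod 2) ℂ :=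
  Matrix.of fun a b => if a.1 = a.2 ∧ b.1 = b.2 then 1 / 2 else 0

/-- Fidelity with the EPR pair, `⟨Ψ⁺| σ |Ψ⁺⟩`. -/
def eprFidelity (σ : Matrix (ZMod 2 × ZMod 2) (ZMod 2 × ZMod 2) ℂ) : ℝ :=
  ((σ * epr).trace).re

/-! ### Entanglement sharing with unknown partner

The qubits of the distributed state are labelled by `Q`, and `owner q` is the party that holds
qubit `q`. -/

section Schemes

/-- The labels of the qubits that are held jointly by the parties in `T`. -/
abbrev Share {n : ℕ} {Q : Type} (owner : Q → Fin n) (T : Finset (Fin n)) : Type :=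
  {q : Q // owner q ∈ T}

/-- A family of linear maps, one for each set of parties, from operators on its shares to
operators on one qubit. -/
abbrev DecoderFamily {n : ℕ} {Q : Type} (owner : Q → Fin n) : Type :=
  ∀ T : Finset (Fin n), Op (Share owner T) →ₗ[ℂ] QubitOp

/-- The basis label of the whole register assembled from labels on the shares of `T`, of `T'`
and of the remaining parties (for disjoint `T` and `T'`). -/
def glue {n : ℕ} {Q : Type} (owner : Q → Fin n) (T T' : Finset (Fin n))
    (x : Share owner T → ZMod 2) (x' : Share owner T' → ZMod 2)
    (e : Share owner (T ∪ T')ᶜ → ZMod 2) : Q → ZMod 2 := fun q =>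
  if h : owner q ∈ T then x ⟨q, h⟩
  else if h' : owner q ∈ T' then x' ⟨q, h'⟩
  else e ⟨q, by simp [h, h']⟩

/-- The reduced state on the shares of `T` and `T'` (for disjoint `T` and `T'`): the partial trace
over the shares of all other parties. -/
def reducedState {n : ℕ} {Q : Type} [Fintype Q] [DecidableEq Q] (owner : Q → Fin n)
    (ρ : Op Q) (T T' : Finset (Fin n)) :
    Matrix ((Share owner T → ZMod 2) × (Share owner T' → ZMod 2))
      ((Share owner T → ZMod 2) × (Share owner T' → ZMod 2)) ℂ :=
  Matrix.of fun x y =>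
    ∑ e, ρ (glue owner T T' x.1 x.2 e) (glue owner T T' y.1 y.2 e)

/-- The two-qubit state `(N_T ⊗ N_T') ρ_{T T'}`. -/
def pairOutput {n : ℕ} {Q : Type} [Fintype Q] [DecidableEq Q] (owner : Q → Fin n)
    (ρ : Op Q) (N : DecoderFamily owner) (T T' : Finset (Fin n)) :
    Matrix (ZMod 2 × ZMod 2) (ZMod 2 × ZMod 2) ℂ :=
  tensorApply (N T) (N T') (reducedState owner ρ T T')

/-- Each pair in `𝒜` obtains an EPR pair, every set of parties using its own decoder whoever
its partner is. -/
def Distills {n : ℕ} {Q : Type} [Fintype Q] [DecidableEq Q] (owner : Q → Fin n)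
    (ρ : Op Q) (N : DecoderFamily owner) (𝒜 : Set (Sym2 (Finset (Fin n)))) : Prop :=
  ∀ T T' : Finset (Fin n), s(T, T') ∈ 𝒜 → pairOutput owner ρ N T T' = epr

/-- `𝒜` is maximal for the state `ρ` and the decoders `N` of the sets in its flattening: no proper
superset of `𝒜` is distilled from `ρ` by a family of channels extending these decoders. -/
def IsMaximal {n : ℕ} {Q : Type} [Fintype Q] [DecidableEq Q] (owner : Q → Fin n)
    (ρ : Op Q) (N : DecoderFamily owner) (𝒜 : Set (Sym2 (Finset (Fin n)))) : Prop :=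
  ¬ ∃ (𝒜' : Set (Sym2 (Finset (Fin n)))) (M : DecoderFamily owner),
    𝒜 ⊂ 𝒜' ∧ PairsDisjoint 𝒜' ∧
    (∀ T ∈ flattening 𝒜', IsChannel (M T)) ∧
    (∀ T ∈ flattening 𝒜, M T = N T) ∧
    Distills owner ρ M 𝒜'

/-- The pairs in `𝒰` are unauthorized: for some `δ > 0`, no choice of local channels in which the
sets of the flattening of `𝒜` keep their decoders gives a pair in `𝒰` an output whose fidelity
with the EPR pair exceeds `1 - δ`. -/
def IsSecure {n : ℕ} {Q : Type} [Fintype Q] [DecidableEq Q] (owner : Q → Fin n)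
    (ρ : Op Q) (N : DecoderFamily owner) (𝒜 𝒰 : Set (Sym2 (Finset (Fin n)))) : Prop :=
  ∃ δ : ℝ, 0 < δ ∧ ∀ T T' : Finset (Fin n), s(T, T') ∈ 𝒰 →
    ∀ M : DecoderFamily owner, IsChannel (M T) → IsChannel (M T') →
      (∀ R ∈ flattening 𝒜, M R = N R) →
      eprFidelity (pairOutput owner ρ M T T') ≤ 1 - δ

/-- `S` is realized by an unknown-partner scheme that consists of a stabilizer state, with
arbitrarily many qubits for each party, and Clifford decoders. -/
def StabilizerRealizable {n : ℕ} (S : PairAccessStructure n) : Prop :=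
  ∃ (Q : Type) (_ : Fintype Q) (_ : DecidableEq Q) (owner : Q → Fin n)
    (ρ : Op Q) (N : DecoderFamily owner),
    IsStabilizerState ρ ∧
    (∀ T ∈ flattening S.authorized, IsCliffordDecoder (N T)) ∧
    Distills owner ρ N S.authorized ∧
    IsSecure owner ρ N S.authorized S.unauthorized ∧
    IsMaximal owner ρ N S.authorized

end Schemes

/-! ### The combinatorial conditions -/

/-- The authorized pair graph has no cycle of odd length. -/
def NoOddCycles {n : ℕ} (𝒜 : Set (Sym2 (Finset (Fin n)))) : Prop :=
  ∀ (p : flattening 𝒜) (c : (authGraph 𝒜).Walk p p), c.IsCycle → ¬ Odd c.length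

/-- Disjoint endpoints of a path of odd length form an authorized pair. -/
def Transitivity {n : ℕ} (𝒜 : Set (Sym2 (Finset (Fin n)))) : Prop :=
  ∀ (p q : flattening 𝒜) (w : (authGraph 𝒜).Walk p q), w.IsPath → Odd w.length →
    Disjoint p.1 q.1 → s(p.1, q.1) ∈ 𝒜

/-- Two vertices are joined by a walk of even length; in a graph without odd cycles this says that
they lie on the same side of the bipartition of one connected component. -/
def SameSide {V : Type*} (G : SimpleGraph V) (p q : V) : Prop :=
  ∃ w : G.Walk p q, Even w.length

/-- `u` solves the linear system over `𝔽₂` of the connected component `C`. -/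
def IsSolution {n : ℕ} (𝒜 : Set (Sym2 (Finset (Fin n)))) (C : (authGraph 𝒜).ConnectedComponent)
    (u : flattening 𝒜 → flattening 𝒜 → Fin n → ZMod 2) : Prop :=
  (∀ p ∈ C.supp, ∀ q ∈ C.supp, ∀ t : Fin n, u p q t ≠ 0 → t ∈ p.1 ∩ q.1) ∧
  (∀ p ∈ C.supp, ∀ q ∈ C.supp, ∑ t, u p q t = 1 ↔ SameSide (authGraph 𝒜) p q) ∧
  (∀ R : Finset (Fin n), R ∉ flattening 𝒜 →
    ∀ p ∈ C.supp, ∀ q ∈ C.supp, ∀ r ∈ C.supp, ∀ s ∈ C.supp,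
      ∑ t ∈ R, (u p q t + u p s t + u r q t + u r s t) = 0)

end ESS

end

/-!
A Clifford decoder for `T` outputs a *virtual qubit*: a pair of anticommuting Hermitian Pauli
operators `X_T`, `Z_T` on the shares of `T` that the channel maps to the Pauli operators of the
output qubit (`IsCliffordDecoder.exists_isPauli`). Two disjoint sets obtain an EPR pair exactly when
`X_T X_T'` and `Z_T Z_T'` fix the state (`pairOutput_eq_epr`, `fixes_of_pairOutput_eq_epr`), so the
whole problem can be read off from these logical operators and their commutation relations.

*Necessity* (`combinatorial_of_realization`). Along a walk the fixed products multiply, so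
`X_p X_r` and `Z_p Z_r` fix the state for all vertices `p`, `r` of one component. Let `u_pq t` be
the contribution of the party `t` to the symplectic product of `X_p` and `Z_q`. It is supported on
`p ∩ q`. Since operators fixing a common nonzero state commute, the total of `u_pq` is
`1 + length` for every walk from `p` to `q`. This rules out odd cycles and gives the sums of the
`u_pq`. Transitivity is maximality applied to the endpoints of an odd path. Finally, if the local
relation failed for some set `R` outside the flattening, the restrictions of `X_p X_r` and `Z_q Z_s`
to `R` would anticommute, and so would the restrictions to the complement of `R`; the two pairs of
restrictions define decoders through which `R` and `Rᶜ` obtain an EPR pair, against maximality. If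
`Rᶜ` already has a decoder, it has an authorized partner inside `R`, and `R` uses the operators of
that partner instead.

*Sufficiency*. Give each party one qubit for every vertex. Let `X_p` be the `X`-type operator with
exponents `u_pq t` on the qubit `(t, q)`, with `u_pq = 0` across components, and let `Z_q` be the
`Z`-type operator on the qubits `(t, q)` with `t ∈ q`. The symplectic product of `X_p` and `Z_q` on
the parties in `R` is then `∑ t ∈ R, u_pq t`. The sum conditions make all `X_p X_r` and `Z_q Z_s`
within components commute, and the state is the maximally mixed state of this CSS code. Decoding
`X_p`, `Z_p` takes a linear permutation of the basis, which is a Clifford unitary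
(`isCliffordDecoder_pauliDecoder`). Now consider a disjoint pair outside `𝒜`. If both sets are
vertices, transitivity puts them in different components, their outputs are uncorrelated, and
the fidelity is `1 / 4` (`eprFidelity_of_not_reachable`). If one of them, `R`, is not a vertex, the
local relations say that the stabilizers commute already on the qubits of `R`; the state is then
separable across the cut at `R` (`exists_product_decomposition`), and the fidelity is at most
`1 / 2` for all local channels (`eprFidelity_tensorApply_le_half`). This bound
(`eprFidelity_cssState_le_half`) gives both security, with `δ = 1 / 2`, and maximality.
-/

open scoped Kronecker

noncomputable section

set_option linter.unusedSectionVars false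

namespace ESS

/-! ### Parity of walks -/

/-- In a graph without odd cycles, shortening a walk to a path preserves the parity of its length:
each piece that `bypass` cuts out is a cycle or runs along one edge and back. -/
lemma even_length_bypass_iff {V : Type*} [DecidableEq V] {G : SimpleGraph V}
    (hG : ∀ (p : V) (c : G.Walk p p), c.IsCycle → ¬ Odd c.length) :
    ∀ {p q : V} (w : G.Walk p q), Even w.bypass.length ↔ Even w.length
  | _, _, .nil => by simp [SimpleGraph.Walk.bypass]
  | p, q, .cons (v := v) h w => by
    have ih := even_length_bypass_iff hG w
    simp only [SimpleGraph.Walk.bypass]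
    split_ifs with hp
    · have htake : Odd (w.bypass.takeUntil p hp).length := by
        have hpath := (w.bypass_isPath).takeUntil hp
        by_cases he : s(p, v) ∈ (w.bypass.takeUntil p hp).edges
        · rw [hpath.length_eq_one_of_mem_edges (Sym2.eq_swap ▸ he)]
          exact odd_one
        · have := hG p (.cons h (w.bypass.takeUntil p hp))
            ((SimpleGraph.Walk.cons_isCycle_iff _ _).2 ⟨hpath, he⟩)
          simpa [Nat.even_add_one] using this
      have hsplit := congrArg SimpleGraph.Walk.length (w.bypass.take_spec hp)
      rw [SimpleGraph.Walk.length_append] at hsplit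
      rw [SimpleGraph.Walk.length_cons, Nat.even_add_one, ← ih, ← hsplit, Nat.even_add,
        ← Nat.not_odd_iff_even (n := (w.bypass.takeUntil p hp).length)]
      tauto
    · rw [SimpleGraph.Walk.length_cons, SimpleGraph.Walk.length_cons, Nat.even_add_one,
        Nat.even_add_one, ih]

/-- Without odd cycles, all walks between two vertices have the same parity. -/
lemma even_length_iff_of_noOddCycles {V : Type*} {G : SimpleGraph V}
    (hG : ∀ (p : V) (c : G.Walk p p), c.IsCycle → ¬ Odd c.length) {p q : V}
    (w w' : G.Walk p q) : Even w.length ↔ Even w'.length := by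
  classical
  have h := even_length_bypass_iff hG (w.append w'.reverse)
  rw [(SimpleGraph.Walk.isPath_iff_nil.1 (w.append w'.reverse).bypass_isPath).length_eq_zero] at h
  simpa [Nat.even_add] using h

/-! ### Signs and Pauli strings -/

/-- The sign `(-1) ^ s`. -/
def sgn (s : ZMod 2) : ℂ := (-1) ^ s.val

@[simp] lemma sgn_zero : sgn 0 = 1 := by simp [sgn]
@[simp] lemma sgn_one : sgn 1 = -1 := by simp [sgn, ZMod.val_one]

lemma zmod_two_cases (s : ZMod 2) : s = 0 ∨ s = 1 := by
  revert s; decide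

lemma sgn_add (s t : ZMod 2) : sgn (s + t) = sgn s * sgn t := by
  rcases zmod_two_cases s with rfl | rfl <;> rcases zmod_two_cases t with rfl | rfl <;>
    simp [CharTwo.add_self_eq_zero]

lemma sgn_sum {ι : Type*} (s : Finset ι) (f : ι → ZMod 2) :
    sgn (∑ i ∈ s, f i) = ∏ i ∈ s, sgn (f i) := by
  classical
  induction s using Finset.induction_on with
  | empty => simp
  | insert i s hi ih => rw [Finset.sum_insert hi, Finset.prod_insert hi, sgn_add, ih]

lemma sgn_mul_self (s : ZMod 2) : sgn s * sgn s = 1 := by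
  rw [← sgn_add, CharTwo.add_self_eq_zero, sgn_zero]

lemma sgn_eq_one_iff {s : ZMod 2} : sgn s = 1 ↔ s = 0 := by
  rcases zmod_two_cases s with rfl | rfl
  · simp
  · simp only [sgn_one, one_ne_zero, iff_false]; norm_num

lemma star_sgn (s : ZMod 2) : star (sgn s) = sgn s := by
  rcases zmod_two_cases s with rfl | rfl <;> simp

section Pauli

variable {κ : Type} [Fintype κ]

lemma pauliString_apply [DecidableEq κ] (a b x y : κ → ZMod 2) :
    pauliString a b x y = if x = y + a then sgn (b ⬝ᵥ y) else 0 := by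
  simp only [pauliString, pauliOne, Matrix.of_apply, dotProduct]
  split_ifs with h
  · rw [sgn_sum]
    exact Finset.prod_congr rfl fun q _ => by simp [h, sgn]
  · obtain ⟨q, hq⟩ := Function.ne_iff.1 h
    exact Finset.prod_eq_zero (Finset.mem_univ q) (if_neg hq)

variable [DecidableEq κ]

lemma pauliString_mul (a b a' b' : κ → ZMod 2) :
    pauliString a b * pauliString a' b' = sgn (b ⬝ᵥ a') • pauliString (a + a') (b + b') := by
  ext x y
  rw [Matrix.mul_apply, Finset.sum_eq_single (y + a')]
  · simp only [pauliString_apply, Matrix.smul_apply, if_true, add_dotProduct, dotProduct_add,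
      sgn_add, smul_eq_mul]
    rw [show y + (a + a') = y + a' + a by abel]
    split_ifs <;> ring
  · intro z _ hz
    simp [pauliString_apply, hz]
  · simp

lemma pauliString_zero : (pauliString 0 0 : Op κ) = 1 := by
  ext x y
  simp [pauliString_apply, Matrix.one_apply]

lemma add_self_eq_zero_fun {κ : Type} (a : κ → ZMod 2) : a + a = 0 :=
  funext fun _ => CharTwo.add_self_eq_zero _

lemma pauliString_conjTranspose (a b : κ → ZMod 2) :
    (pauliString a b).conjTranspose = sgn (b ⬝ᵥ a) • pauliString a b := by
  ext x y
  simp only [Matrix.conjTranspose_apply, pauliString_apply, Matrix.smul_apply, smul_eq_mul]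
  have h : y = x + a ↔ x = y + a := by
    constructor <;> rintro rfl <;> rw [add_assoc, add_self_eq_zero_fun, add_zero]
  simp only [h]
  split_ifs with hx
  · subst hx
    rw [star_sgn, dotProduct_add, sgn_add, mul_comm]
  · simp

/-- Pauli strings commute up to the sign of the symplectic form. -/
lemma pauliString_mul_comm (a b a' b' : κ → ZMod 2) :
    pauliString a b * pauliString a' b' =
      sgn (a ⬝ᵥ b' + b ⬝ᵥ a') • (pauliString a' b' * pauliString a b) := by
  rw [pauliString_mul, pauliString_mul, smul_smul, add_comm a', add_comm b', sgn_add,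
    dotProduct_comm b' a, mul_comm (sgn (a ⬝ᵥ b')), mul_assoc, sgn_mul_self, mul_one]

end Pauli

/-! ### Operators on the shares of a set of parties -/

section Lift

variable {n : ℕ} {Q : Type} [Fintype Q] [DecidableEq Q] (owner : Q → Fin n)

/-- The operator on the whole register that acts as `M` on the shares of `T` and trivially on all
other qubits. -/
def lift (T : Finset (Fin n)) : Op (Share owner T) →ₐ[ℂ] Op Q :=
  let e := Equiv.piEquivPiSubtypeProd (fun q => owner q ∈ T) (fun _ => ZMod 2)
  AlgHom.ofLinearMap
    { toFun := fun M => (M ⊗ₖ (1 : Op {q // owner q ∉ T})).submatrix e e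
      map_add' := fun M N => by rw [Matrix.add_kronecker]; rfl
      map_smul' := fun c M => by rw [Matrix.smul_kronecker]; rfl }
    (by simp)
    (fun M N => by
      simp only [LinearMap.coe_mk, AddHom.coe_mk]
      rw [Matrix.submatrix_mul_equiv, ← Matrix.mul_kronecker_mul, mul_one])

lemma lift_apply (T : Finset (Fin n)) (M : Op (Share owner T)) (x y : Q → ZMod 2) :
    lift owner T M x y =
      if ∀ q, owner q ∉ T → x q = y q then M (fun q => x q) (fun q => y q) else 0 := by
  change M (fun q => x q) (fun q => y q) *
    (1 : Op {q // owner q ∉ T}) (fun q => x q) (fun q => y q) = _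
  simp [Matrix.one_apply, funext_iff]

lemma lift_conjTranspose (T : Finset (Fin n)) (M : Op (Share owner T)) :
    lift owner T M.conjTranspose = (lift owner T M).conjTranspose := by
  ext x y
  simp only [lift_apply, Matrix.conjTranspose_apply, eq_comm (a := x _)]
  split_ifs <;> simp

/-- The extension by zero of a label on the shares of `T` to the whole register. -/
def extendZero (T : Finset (Fin n)) (a : Share owner T → ZMod 2) : Q → ZMod 2 :=
  fun q => if h : owner q ∈ T then a ⟨q, h⟩ else 0

lemma extendZero_of_notMem {T : Finset (Fin n)} (a : Share owner T → ZMod 2) {q : Q}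
    (hq : owner q ∉ T) : extendZero owner T a q = 0 := dif_neg hq

lemma extendZero_restrict {T : Finset (Fin n)} {a : Q → ZMod 2}
    (ha : ∀ q, owner q ∉ T → a q = 0) : extendZero owner T (fun q => a q) = a := by
  funext q
  by_cases h : owner q ∈ T
  · simp [extendZero, h]
  · simp [extendZero, h, ha q h]

lemma sum_share (T : Finset (Fin n)) (f : Q → ZMod 2) :
    ∑ q : Share owner T, f q = ∑ q, if owner q ∈ T then f q else 0 := by
  rw [← Finset.sum_filter]
  exact (Finset.sum_subtype _ (by simp) f).symm

lemma lift_pauliString (T : Finset (Fin n)) (a b : Share owner T → ZMod 2) :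
    lift owner T (pauliString a b) = pauliString (extendZero owner T a) (extendZero owner T b) := by
  ext x y
  have hdot : extendZero owner T b ⬝ᵥ y = b ⬝ᵥ fun q : Share owner T => y q := by
    simp only [dotProduct]
    rw [← Fintype.sum_subtype_add_sum_subtype (fun q => owner q ∈ T)]
    rw [Finset.sum_congr rfl (g := fun _ => 0)
      (s₁ := (Finset.univ : Finset {q // owner q ∉ T}))
      (fun q _ => by rw [extendZero_of_notMem owner b q.2, zero_mul])]
    simp only [Finset.sum_const_zero, add_zero]
    exact Finset.sum_congr rfl fun q _ => by simp [extendZero, q.2]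
  have hiff : x = y + extendZero owner T a ↔ (∀ q, owner q ∉ T → x q = y q) ∧
      (fun q : Share owner T => x q) = (fun q : Share owner T => y q) + a := by
    constructor
    · rintro rfl
      refine ⟨fun q hq => by simp [extendZero_of_notMem owner a hq], ?_⟩
      funext q
      simp [extendZero, q.2]
    · rintro ⟨h1, h2⟩
      funext q
      by_cases hq : owner q ∈ T
      · simpa [extendZero, hq] using congrFun h2 ⟨q, hq⟩
      · simpa [extendZero, hq] using h1 q hq
  rw [lift_apply, pauliString_apply, pauliString_apply, hdot]
  simp only [hiff, ite_and]

variable {T T' : Finset (Fin n)}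

/-- Labels on the shares of two disjoint sets and on the rest amount to labels on the whole
register. -/
def glueEquiv (hT : Disjoint T T') :
    ((Share owner T → ZMod 2) × (Share owner T' → ZMod 2)) ×
      (Share owner (T ∪ T')ᶜ → ZMod 2) ≃ (Q → ZMod 2) where
  toFun z := glue owner T T' z.1.1 z.1.2 z.2
  invFun x := ((fun q => x q, fun q => x q), fun q => x q)
  left_inv z := by
    obtain ⟨⟨x, x'⟩, e⟩ := z
    refine Prod.ext (Prod.ext ?_ ?_) ?_
    · funext q
      simp [glue, q.2]
    · funext q
      simp [glue, q.2, Finset.disjoint_right.1 hT q.2]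
    · funext q
      have := q.2
      simp only [Finset.mem_compl, Finset.mem_union, not_or] at this
      simp [glue, this.1, this.2]
  right_inv x := by
    funext q
    simp only [glue]
    split_ifs <;> rfl

lemma glueEquiv_apply (hT : Disjoint T T') (x : Share owner T → ZMod 2)
    (x' : Share owner T' → ZMod 2) (e : Share owner (T ∪ T')ᶜ → ZMod 2) :
    glueEquiv owner hT ((x, x'), e) = glue owner T T' x x' e := rfl

lemma glueEquiv_symm_apply (hT : Disjoint T T') (x : Q → ZMod 2) :
    (glueEquiv owner hT).symm x =
      ((fun q : Share owner T => x q, fun q : Share owner T' => x q),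
        fun q : Share owner (T ∪ T')ᶜ => x q) := rfl

lemma submatrix_lift_left (hT : Disjoint T T') (M : Op (Share owner T)) :
    (M ⊗ₖ (1 : Op (Share owner T'))) ⊗ₖ (1 : Op (Share owner (T ∪ T')ᶜ)) =
    (lift owner T M).submatrix (glueEquiv owner hT) (glueEquiv owner hT) := by
  rw [← (Matrix.reindex (glueEquiv owner hT) (glueEquiv owner hT)).injective.eq_iff]
  ext x y
  simp only [Matrix.reindex_apply, Matrix.submatrix_apply, Equiv.apply_symm_apply]
  simp only [lift_apply, glueEquiv_symm_apply, Matrix.kroneckerMap_apply,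
    Matrix.one_apply]
  have : (∀ q, owner q ∉ T → x q = y q) ↔
      ((fun q : Share owner T' => x q) = fun q : Share owner T' => y q) ∧
      ((fun q : Share owner (T ∪ T')ᶜ => x q) = fun q : Share owner (T ∪ T')ᶜ => y q) := by
    simp only [funext_iff, Subtype.forall, Finset.mem_compl, Finset.mem_union, not_or]
    constructor
    · exact fun h => ⟨fun q hq => h q (Finset.disjoint_right.1 hT hq), fun q hq => h q hq.1⟩
    · intro h q hq
      by_cases hq' : owner q ∈ T'
      · exact h.1 q hq'
      · exact h.2 q ⟨hq, hq'⟩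
  rw [if_congr this rfl rfl, ite_and]
  split_ifs <;> ring

lemma submatrix_lift_right (hT : Disjoint T T') (M : Op (Share owner T')) :
    ((1 : Op (Share owner T)) ⊗ₖ M) ⊗ₖ (1 : Op (Share owner (T ∪ T')ᶜ)) =
    (lift owner T' M).submatrix (glueEquiv owner hT) (glueEquiv owner hT) := by
  rw [← (Matrix.reindex (glueEquiv owner hT) (glueEquiv owner hT)).injective.eq_iff]
  ext x y
  simp only [Matrix.reindex_apply, Matrix.submatrix_apply, Equiv.apply_symm_apply]
  simp only [lift_apply, glueEquiv_symm_apply, Matrix.kroneckerMap_apply,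
    Matrix.one_apply]
  have : (∀ q, owner q ∉ T' → x q = y q) ↔
      ((fun q : Share owner T => x q) = fun q : Share owner T => y q) ∧
      ((fun q : Share owner (T ∪ T')ᶜ => x q) = fun q : Share owner (T ∪ T')ᶜ => y q) := by
    simp only [funext_iff, Subtype.forall, Finset.mem_compl, Finset.mem_union, not_or]
    constructor
    · exact fun h => ⟨fun q hq => h q (Finset.disjoint_left.1 hT hq), fun q hq => h q hq.2⟩
    · intro h q hq
      by_cases hq' : owner q ∈ T
      · exact h.1 q hq'
      · exact h.2 q ⟨hq', hq⟩
  rw [if_congr this rfl rfl, ite_and]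
  split_ifs <;> ring

lemma submatrix_lift_mul_lift (hT : Disjoint T T') (M : Op (Share owner T))
    (M' : Op (Share owner T')) :
    (lift owner T M * lift owner T' M').submatrix (glueEquiv owner hT) (glueEquiv owner hT) =
      (M ⊗ₖ M') ⊗ₖ (1 : Op (Share owner (T ∪ T')ᶜ)) := by
  rw [← Matrix.submatrix_mul_equiv _ _ _ (glueEquiv owner hT), ← submatrix_lift_left,
    ← submatrix_lift_right, ← Matrix.mul_kronecker_mul, ← Matrix.mul_kronecker_mul, mul_one,
    one_mul, mul_one]

/-- Operators on the shares of disjoint sets of parties commute. -/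
lemma commute_lift (hT : Disjoint T T') (M : Op (Share owner T)) (M' : Op (Share owner T')) :
    Commute (lift owner T M) (lift owner T' M') := by
  rw [Commute, SemiconjBy]
  apply (Matrix.reindex (glueEquiv owner hT).symm (glueEquiv owner hT).symm).injective
  rw [Matrix.reindex_apply, Matrix.reindex_apply, Equiv.symm_symm, submatrix_lift_mul_lift,
    ← Matrix.submatrix_mul_equiv _ _ _ (glueEquiv owner hT),
    ← submatrix_lift_left, ← submatrix_lift_right, ← Matrix.mul_kronecker_mul,
    ← Matrix.mul_kronecker_mul, mul_one, one_mul, mul_one]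

/-- The output of a pair of decoders in the Heisenberg picture: if `E` and `E'` are dual to the
decoders, then the matrix entries of the output are expectation values in the state `ρ`. -/
lemma pairOutput_apply (hT : Disjoint T T') (ρ : Op Q) (N : DecoderFamily owner)
    {E : ZMod 2 → ZMod 2 → Op (Share owner T)} {E' : ZMod 2 → ZMod 2 → Op (Share owner T')}
    (hE : ∀ σ i j, N T σ i j = (σ * E j i).trace)
    (hE' : ∀ σ i j, N T' σ i j = (σ * E' j i).trace) (i i' j j' : ZMod 2) :
    pairOutput owner ρ N T T' (i, i') (j, j') =
      (ρ * (lift owner T (E j i) * lift owner T' (E' j' i'))).trace := by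
  have htrace : ∀ M : Op Q, M.trace =
      (M.submatrix (glueEquiv owner hT) (glueEquiv owner hT)).trace := fun M => by
    simp only [Matrix.trace, Matrix.diag_apply, Matrix.submatrix_apply]
    exact ((glueEquiv owner hT).sum_comp fun x => M x x).symm
  rw [htrace, ← Matrix.submatrix_mul_equiv _ _ _ (glueEquiv owner hT), submatrix_lift_mul_lift]
  have hone : ∀ {α : Type} [Fintype α] [DecidableEq α] (x y : α) (F : Matrix α α ℂ),
      (Matrix.single x y (1 : ℂ) * F).trace = F y x := fun x y F => by
    rw [Matrix.trace_mul_comm, Matrix.trace_mul_single]; simp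
  simp only [pairOutput, tensorApply, Matrix.sum_apply, Matrix.smul_apply,
    Matrix.kroneckerMap_apply, hE, hE', hone, reducedState, Matrix.of_apply, smul_eq_mul]
  simp only [Matrix.trace, Matrix.diag_apply, Matrix.mul_apply, Matrix.submatrix_apply,
    Fintype.sum_prod_type, glueEquiv_apply, Matrix.kroneckerMap_apply, Matrix.one_apply]
  refine Finset.sum_congr rfl fun x _ => ?_
  simp only [mul_ite, mul_one, mul_zero, Finset.sum_ite_eq', Finset.mem_univ, if_true,
    Finset.sum_mul]
  rw [Finset.sum_comm]
  refine Finset.sum_congr rfl fun x' _ => ?_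
  conv_rhs => rw [Finset.sum_comm]
  refine Finset.sum_congr rfl fun y _ => ?_
  rw [Finset.sum_comm]

end Lift

/-! ### Decoders in the Heisenberg picture -/

lemma sum_zmod_two {M : Type*} [AddCommMonoid M] (f : ZMod 2 → M) : ∑ i, f i = f 0 + f 1 :=
  Fin.sum_univ_two f

section Decoder

variable {α : Type} [Fintype α] [DecidableEq α]

/-- Anticommuting Hermitian involutions: the operators `A` and `B` behave like the Pauli operators
`X` and `Z` of a (virtual) qubit. -/
structure IsQubitPair (A B : Matrix α α ℂ) : Prop where
  hermitian_left : A.conjTranspose = A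
  hermitian_right : B.conjTranspose = B
  sq_left : A * A = 1
  sq_right : B * B = 1
  anticomm : A * B = -(B * A)

/-- The projection onto the `+1` eigenspace of an involution `B`. -/
def halfProj (B : Matrix α α ℂ) : Matrix α α ℂ := (1 / 2 : ℂ) • (1 + B)

/-- The operator of the virtual qubit with Pauli operators `A` and `B` that corresponds to
`|j⟩⟨i|`. -/
def decoderDual (A B : Matrix α α ℂ) (j i : ZMod 2) : Matrix α α ℂ :=
  A ^ j.val * halfProj B * A ^ i.val

/-- The channel that outputs the virtual qubit with Pauli operators `A` and `B`: its dual maps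
`|j⟩⟨i|` to `decoderDual A B j i`, hence `X` to `A` and `Z` to `B`. -/
def pauliDecoder (A B : Matrix α α ℂ) : Matrix α α ℂ →ₗ[ℂ] QubitOp where
  toFun σ := Matrix.of fun i j => (σ * decoderDual A B j i).trace
  map_add' σ τ := by ext i j; simp [add_mul, Matrix.trace_add]
  map_smul' c σ := by ext i j; simp

lemma pauliDecoder_apply (A B σ : Matrix α α ℂ) (i j : ZMod 2) :
    pauliDecoder A B σ i j = (σ * decoderDual A B j i).trace := rfl

@[simp] lemma decoderDual_zero_zero (A B : Matrix α α ℂ) : decoderDual A B 0 0 = halfProj B := by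
  simp [decoderDual]
@[simp] lemma decoderDual_zero_one (A B : Matrix α α ℂ) :
    decoderDual A B 0 1 = halfProj B * A := by
  simp [decoderDual, ZMod.val_one]
@[simp] lemma decoderDual_one_zero (A B : Matrix α α ℂ) :
    decoderDual A B 1 0 = A * halfProj B := by
  simp [decoderDual, ZMod.val_one]
@[simp] lemma decoderDual_one_one (A B : Matrix α α ℂ) :
    decoderDual A B 1 1 = A * halfProj B * A := by
  simp [decoderDual, ZMod.val_one]

lemma halfProj_add_neg (B : Matrix α α ℂ) : halfProj B + halfProj (-B) = 1 := by
  simp only [halfProj, ← smul_add]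
  rw [show (1 : Matrix α α ℂ) + B + (1 + -B) = (2 : ℂ) • 1 by rw [two_smul]; abel, smul_smul]
  norm_num

lemma halfProj_sub_neg (B : Matrix α α ℂ) : halfProj B - halfProj (-B) = B := by
  simp only [halfProj, ← smul_sub]
  rw [show (1 : Matrix α α ℂ) + B - (1 + -B) = (2 : ℂ) • B by rw [two_smul]; abel, smul_smul]
  norm_num

namespace IsQubitPair

variable {A B : Matrix α α ℂ}

lemma left_mul_halfProj (h : IsQubitPair A B) : A * halfProj B = halfProj (-B) * A := by
  simp [halfProj, mul_add, add_mul, h.anticomm]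

lemma halfProj_sq (h : IsQubitPair A B) : halfProj B * halfProj B = halfProj B := by
  simp only [halfProj, smul_mul_smul_comm, mul_add, add_mul, one_mul, mul_one, h.sq_right]
  rw [show (1 : Matrix α α ℂ) + B + (B + 1) = (2 : ℂ) • (1 + B) by rw [two_smul]; abel, smul_smul]
  norm_num

lemma halfProj_mul_neg (h : IsQubitPair A B) : halfProj B * halfProj (-B) = 0 := by
  rw [eq_sub_of_add_eq' (halfProj_add_neg B), mul_sub, mul_one, h.halfProj_sq, sub_self]

lemma conjTranspose_halfProj (h : IsQubitPair A B) : (halfProj B).conjTranspose = halfProj B := by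
  simp [halfProj, Matrix.conjTranspose_smul, Matrix.conjTranspose_add, h.hermitian_right]

lemma left_halfProj_left (h : IsQubitPair A B) : A * halfProj B * A = halfProj (-B) := by
  rw [h.left_mul_halfProj, mul_assoc, h.sq_left, mul_one]

lemma halfProj_left_halfProj (h : IsQubitPair A B) : halfProj B * A * halfProj B = 0 := by
  rw [mul_assoc, h.left_mul_halfProj, ← mul_assoc, h.halfProj_mul_neg, zero_mul]

lemma dual_X (h : IsQubitPair A B) : decoderDual A B 1 0 + decoderDual A B 0 1 = A := by
  rw [decoderDual_one_zero, decoderDual_zero_one, h.left_mul_halfProj, ← add_mul,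
    add_comm, halfProj_add_neg, one_mul]

lemma dual_Z (h : IsQubitPair A B) : decoderDual A B 0 0 - decoderDual A B 1 1 = B := by
  rw [decoderDual_zero_zero, decoderDual_one_one, h.left_halfProj_left, halfProj_sub_neg]

/-- The decoder of a virtual qubit is a channel: it applies `V_i = ½(1 + B) A ^ i` for the output
basis state `i` and discards the register, so its Kraus operators are the rows of the `V_i`. -/
lemma isChannel (h : IsQubitPair A B) : IsChannel (pauliDecoder A B) := by
  let V : ZMod 2 → Matrix α α ℂ := fun i => halfProj B * A ^ i.val
  have hV : ∀ i j, (V j).conjTranspose * V i = decoderDual A B j i := fun i j => by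
    simp only [V, Matrix.conjTranspose_mul, Matrix.conjTranspose_pow, h.hermitian_left,
      h.conjTranspose_halfProj, decoderDual]
    rw [mul_assoc, ← mul_assoc (halfProj B), h.halfProj_sq, mul_assoc]
  let K : α → Matrix (ZMod 2) α ℂ := fun w => Matrix.of fun i y => V i w y
  refine ⟨Fintype.card α, fun k => K ((Fintype.equivFin α).symm k), ?_, fun σ => ?_⟩
  · rw [(Fintype.equivFin α).symm.sum_comp fun w => (K w).conjTranspose * K w]
    have : ∑ w, (K w).conjTranspose * K w = ∑ i, (V i).conjTranspose * V i := by
      ext x y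
      simp only [Matrix.sum_apply, Matrix.mul_apply, Matrix.conjTranspose_apply, K,
        Matrix.of_apply]
      rw [Finset.sum_comm]
    rw [this, sum_zmod_two, hV, hV, decoderDual_zero_zero, decoderDual_one_one,
      h.left_halfProj_left, halfProj_add_neg]
  · rw [(Fintype.equivFin α).symm.sum_comp fun w => K w * σ * (K w).conjTranspose]
    ext i j
    rw [pauliDecoder_apply, ← hV, ← mul_assoc, Matrix.trace_mul_comm, ← mul_assoc]
    simp only [Matrix.sum_apply, Matrix.mul_apply, Matrix.conjTranspose_apply, K,
        Matrix.of_apply, Matrix.trace, Matrix.diag_apply]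

end IsQubitPair

end Decoder

/-! ### States fixed by operators -/

section State

variable {α : Type} [Fintype α] [DecidableEq α]

/-- The properties of a (nonzero) stabilizer state that matter for decoding: it is Hermitian of
trace one and proportional to a projection. -/
structure IsFlatState (ρ : Matrix α α ℂ) : Prop where
  hermitian : ρ.conjTranspose = ρ
  trace_eq_one : ρ.trace = 1
  sq : ∃ c : ℂ, ρ * ρ = c • ρ

open scoped ComplexOrder in
/-- A Hermitian involution with expectation value one fixes the state. -/
lemma IsFlatState.mul_eq_self {ρ : Matrix α α ℂ} (hρ : IsFlatState ρ) {M : Matrix α α ℂ}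
    (hM : M.conjTranspose = M) (hM2 : M * M = 1) (htr : (ρ * M).trace = 1) : M * ρ = ρ := by
  obtain ⟨c, hc⟩ := hρ.sq
  have key : (((1 - M) * ρ).conjTranspose * ((1 - M) * ρ)).trace = 0 := by
    rw [Matrix.conjTranspose_mul, hρ.hermitian, Matrix.conjTranspose_sub, hM,
      Matrix.conjTranspose_one]
    have : ρ * (1 - M) * ((1 - M) * ρ) = (2 : ℂ) • (ρ * ρ) - (2 : ℂ) • (ρ * M * ρ) := by
      have h1 : ρ * (1 - M) * ((1 - M) * ρ) = ρ * ρ - ρ * M * ρ - ρ * M * ρ + ρ * (M * M) * ρ := by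
        noncomm_ring
      rw [h1, hM2, mul_one, two_smul, two_smul]
      abel
    rw [this, Matrix.trace_sub, Matrix.trace_smul, Matrix.trace_smul,
      Matrix.trace_mul_comm (ρ * M), ← mul_assoc, hc, Matrix.smul_mul, Matrix.trace_smul,
      Matrix.trace_smul, htr, hρ.trace_eq_one, sub_self]
  have := Matrix.trace_conjTranspose_mul_self_eq_zero_iff.1 key
  rw [sub_mul, one_mul, sub_eq_zero] at this
  exact this.symm

lemma IsFlatState.ne_zero {ρ : Matrix α α ℂ} (hρ : IsFlatState ρ) : ρ ≠ 0 := by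
  rintro rfl
  simpa using hρ.trace_eq_one

lemma IsFlatState.mul_eq_self_right {ρ : Matrix α α ℂ} (hρ : IsFlatState ρ) {M : Matrix α α ℂ}
    (hM : M.conjTranspose = M) (h : M * ρ = ρ) : ρ * M = ρ := by
  simpa [Matrix.conjTranspose_mul, hρ.hermitian, hM] using congrArg Matrix.conjTranspose h

/-- An operator that anticommutes with an operator fixing the state has expectation value zero. -/
lemma trace_eq_zero_of_anticomm {ρ g M : Matrix α α ℂ} (h1 : g * ρ = ρ) (h2 : ρ * g = ρ)
    (h : g * M = -(M * g)) : (ρ * M).trace = 0 := by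
  have : (ρ * M).trace = -(ρ * M).trace := by
    conv_lhs => rw [← h2, mul_assoc, h, mul_neg, Matrix.trace_neg, Matrix.trace_mul_comm,
      mul_assoc, h1, Matrix.trace_mul_comm]
  linear_combination (1 / 2 : ℂ) * this

variable {A B A' B' : Matrix α α ℂ}

/-- If the joint operators `A A'` and `B B'` of two commuting virtual qubits fix the state, then
the two qubits are in the EPR state. -/
lemma trace_dual_mul_dual_of_fixes {ρ : Matrix α α ℂ} (hρ : IsFlatState ρ) (h : IsQubitPair A B)
    (h' : IsQubitPair A' B') (hAA : Commute A A') (hAB : Commute A B') (hBA : Commute B A')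
    (hBB : Commute B B') (hX : A * A' * ρ = ρ) (hZ : B * B' * ρ = ρ) (i i' j j' : ZMod 2) :
    (ρ * (decoderDual A B j i * decoderDual A' B' j' i')).trace =
      epr (i, i') (j, j') := by
  have hX1 : A' * ρ = A * ρ := by
    conv_rhs => rw [← hX, ← mul_assoc, ← mul_assoc, h.sq_left, one_mul]
  have hZ1 : B' * ρ = B * ρ := by
    conv_rhs => rw [← hZ, ← mul_assoc, ← mul_assoc, h.sq_right, one_mul]
  have hX2 : ρ * A' = ρ * A := by
    simpa [Matrix.conjTranspose_mul, hρ.hermitian, h.hermitian_left, h'.hermitian_left]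
      using congrArg Matrix.conjTranspose hX1
  have hZ2 : ρ * B' = ρ * B := by
    simpa [Matrix.conjTranspose_mul, hρ.hermitian, h.hermitian_right, h'.hermitian_right]
      using congrArg Matrix.conjTranspose hZ1
  have hP1 : halfProj B' * ρ = halfProj B * ρ := by simp [halfProj, add_mul, hZ1]
  have hAP : Commute A (halfProj B') := ((Commute.one_right A).add_right hAB).smul_right _
  have hPA : Commute A' (halfProj B) := ((Commute.one_right A').add_right hBA.symm).smul_right _
  have hzero : (ρ * B).trace = 0 :=
    trace_eq_zero_of_anticomm hX (by rw [hAA.eq, ← mul_assoc, hX2, mul_assoc, h.sq_left, mul_one])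
      (by rw [mul_assoc, hBA.symm.eq, ← mul_assoc, h.anticomm, neg_mul, mul_assoc])
  -- Moving the primed operators onto `ρ` turns them into unprimed ones.
  have hleft : ρ * (A ^ j.val * A' ^ j'.val) = ρ * A ^ (j + j').val := by
    rw [(hAA.pow_pow _ _).eq, ← mul_assoc]
    rcases zmod_two_cases j with rfl | rfl <;> rcases zmod_two_cases j' with rfl | rfl <;>
      simp [ZMod.val_one, hX2, CharTwo.add_self_eq_zero, mul_assoc, h.sq_left]
  have hright : A ^ i.val * A' ^ i'.val * ρ = A ^ (i + i').val * ρ := by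
    rw [mul_assoc]
    rcases zmod_two_cases i with rfl | rfl <;> rcases zmod_two_cases i' with rfl | rfl <;>
      simp [ZMod.val_one, hX1, CharTwo.add_self_eq_zero, ← mul_assoc, h.sq_left]
  have hmain : (ρ * (decoderDual A B j i * decoderDual A' B' j' i')).trace =
      (ρ * A ^ (j + j').val * (halfProj B * (A ^ (i + i').val * halfProj B))).trace := by
    have e1 : decoderDual A B j i * decoderDual A' B' j' i' =
        (A ^ j.val * A' ^ j'.val) * (halfProj B * halfProj B') * (A ^ i.val * A' ^ i'.val) := by
      simp only [decoderDual]
      have c1 := (hAA.pow_pow i.val j'.val).eq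
      have c2 := (hPA.pow_left j'.val).eq
      have c3 := (hAP.pow_left i.val).eq
      calc _ = A ^ j.val * halfProj B * (A ^ i.val * A' ^ j'.val) * halfProj B' * A' ^ i'.val := by
            noncomm_ring
        _ = A ^ j.val * (halfProj B * A' ^ j'.val) * (A ^ i.val * halfProj B') * A' ^ i'.val := by
            rw [c1]; noncomm_ring
        _ = _ := by rw [← c2, c3]; noncomm_ring
    rw [e1]
    calc _ = (A ^ i.val * A' ^ i'.val * ρ * (A ^ j.val * A' ^ j'.val) *
            (halfProj B * halfProj B')).trace := by
          rw [← mul_assoc, Matrix.trace_mul_comm]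
          simp only [mul_assoc]
      _ = (A ^ (i + i').val * (ρ * A ^ (j + j').val) * (halfProj B * halfProj B')).trace := by
          rw [hright, mul_assoc (A ^ (i + i').val), hleft]
      _ = ((halfProj B' * A ^ (i + i').val) * ρ * (A ^ (j + j').val * halfProj B)).trace := by
          rw [← mul_assoc _ (halfProj B), Matrix.trace_mul_comm]
          simp only [mul_assoc]
      _ = _ := by
          rw [← (hAP.pow_left _).eq, mul_assoc _ (halfProj B') ρ, hP1, ← mul_assoc _ _ ρ,
            mul_assoc _ ρ, Matrix.trace_mul_comm]
          simp only [mul_assoc]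
  have hzero' : (ρ * (A * halfProj B)).trace = 0 := by
    have hcomm : Commute B (halfProj B) :=
      ((Commute.one_right B).add_right (Commute.refl B)).smul_right _
    have hcomm' : Commute B' (halfProj B) :=
      ((Commute.one_right B').add_right hBB.symm).smul_right _
    have hBA' : B * A = -(A * B) := by rw [h.anticomm, neg_neg]
    refine trace_eq_zero_of_anticomm hZ
      (by rw [hBB.eq, ← mul_assoc, hZ2, mul_assoc, h.sq_right, mul_one]) ?_
    calc B * B' * (A * halfProj B) = B * (B' * A) * halfProj B := by simp only [mul_assoc]
      _ = B * A * (B' * halfProj B) := by rw [hAB.symm.eq]; simp only [mul_assoc]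
      _ = -(A * (B * halfProj B) * B') := by
          rw [hBA', hcomm'.eq]; simp only [mul_assoc, neg_mul]
      _ = _ := by rw [hcomm.eq]; simp only [mul_assoc]
  have hone : (ρ * halfProj B).trace = 1 / 2 := by
    simp [halfProj, mul_add, hzero, hρ.trace_eq_one]
  rw [hmain]
  have hi : i = i' ↔ i + i' = 0 := (CharTwo.add_eq_zero).symm
  have hj : j = j' ↔ j + j' = 0 := (CharTwo.add_eq_zero).symm
  simp only [epr, Matrix.of_apply, hi, hj]
  rcases zmod_two_cases (i + i') with hi | hi <;> rcases zmod_two_cases (j + j') with hj | hj <;>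
    rw [hi, hj] <;> simp only [ZMod.val_one, ZMod.val_zero, pow_one, pow_zero, one_mul, mul_one,
      h.halfProj_sq, ← mul_assoc (halfProj B) A, h.halfProj_left_halfProj]
  · simpa using hone
  · rw [mul_assoc]; simpa using hzero'
  · simp
  · simp

end State

/-! ### Clifford decoders -/

section Clifford

variable {κ : Type} [Fintype κ] [DecidableEq κ]

/-- Pauli `X` on the qubit `o`. -/
abbrev pauliX (o : κ) : Op κ := pauliString (Pi.single o 1) 0

/-- Pauli `Z` on the qubit `o`. -/
abbrev pauliZ (o : κ) : Op κ := pauliString 0 (Pi.single o 1)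

lemma isQubitPair_pauliString {a b a' b' : κ → ZMod 2} (h1 : b ⬝ᵥ a = 0) (h2 : b' ⬝ᵥ a' = 0)
    (h : a ⬝ᵥ b' + b ⬝ᵥ a' = 1) : IsQubitPair (pauliString a b) (pauliString a' b') where
  hermitian_left := by simp [pauliString_conjTranspose, h1]
  hermitian_right := by simp [pauliString_conjTranspose, h2]
  sq_left := by
    simp [pauliString_mul, h1, add_self_eq_zero_fun, pauliString_zero]
  sq_right := by
    simp [pauliString_mul, h2, add_self_eq_zero_fun, pauliString_zero]
  anticomm := by rw [pauliString_mul_comm, h]; simp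

lemma isQubitPair_pauliX_pauliZ (o : κ) : IsQubitPair (pauliX o) (pauliZ o) :=
  isQubitPair_pauliString (by simp) (by simp) (by simp)

lemma halfProj_pauliString (b x y : κ → ZMod 2) :
    halfProj (pauliString 0 b) x y = if x = y ∧ b ⬝ᵥ y = 0 then 1 else 0 := by
  simp only [halfProj, Matrix.smul_apply, Matrix.add_apply, Matrix.one_apply, pauliString_apply,
    add_zero, smul_eq_mul]
  by_cases h : x = y
  · rcases zmod_two_cases (b ⬝ᵥ y) with h' | h' <;> (simp [h, h']; try norm_num)
  · simp [h]

/-- Tracing out all qubits but `o` is the decoder of the Pauli operators of the qubit `o`. -/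
lemma partialTrace_eq_pauliDecoder (o : κ) (τ : Op κ) (i j : ZMod 2) :
    (∑ x : κ → ZMod 2, if x o = i then τ x (Function.update x o j) else 0) =
      pauliDecoder (pauliX o) (pauliZ o) τ i j := by
  have hX : ∀ i : ZMod 2, pauliX o ^ i.val = pauliString (Pi.single o i) 0 := fun i => by
    rcases zmod_two_cases i with rfl | rfl <;> simp [ZMod.val_one, pauliString_zero]
  have hdual : ∀ x y, decoderDual (pauliX o) (pauliZ o) j i y x =
      if x o = i ∧ y = Function.update x o j then 1 else 0 := fun x y => by
    simp only [decoderDual, hX, Matrix.mul_apply, halfProj_pauliString, pauliString_apply,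
      zero_dotProduct, sgn_zero, single_dotProduct, one_mul]
    rw [Finset.sum_eq_single (x + Pi.single o i)]
    · rw [Finset.sum_eq_single (x + Pi.single o i)]
      · have hcond : (x + (Pi.single o i : κ → ZMod 2)) o = 0 ↔ x o = i := by
          simp [CharTwo.add_eq_zero]
        simp only [hcond, if_true, true_and, mul_one, mul_ite, mul_zero]
        by_cases hx : x o = i
        · have : x + Pi.single o i + Pi.single o j = Function.update x o j := by
            funext q
            by_cases hq : q = o
            · subst hq; simp [hx, CharTwo.add_self_eq_zero]
            · simp [hq]
          simp [hx, this]
        · simp [hx]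
      · intro z _ hz
        simp [hz]
      · simp
    · intro z _ hz
      simp [hz]
    · simp
  simp only [pauliDecoder_apply, Matrix.trace, Matrix.diag_apply, Matrix.mul_apply, hdual]
  refine Finset.sum_congr rfl fun x _ => ?_
  simp [ite_and]

lemma unitary_conj_mul (U : Matrix.unitaryGroup (κ → ZMod 2) ℂ) (M N : Op κ) :
    ((U : Op κ).conjTranspose * M * (U : Op κ)) * ((U : Op κ).conjTranspose * N * (U : Op κ)) =
      (U : Op κ).conjTranspose * (M * N) * U := by
  have h : (U : Op κ) * (U : Op κ).conjTranspose = 1 := U.2.2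
  calc _ = (U : Op κ).conjTranspose * M * ((U : Op κ) * (U : Op κ).conjTranspose) * N * U := by
        noncomm_ring
    _ = _ := by rw [h]; noncomm_ring

lemma unitary_conj_one (U : Matrix.unitaryGroup (κ → ZMod 2) ℂ) :
    (U : Op κ).conjTranspose * 1 * (U : Op κ) = 1 := by
  rw [mul_one]; exact U.2.1

lemma unitary_conj_pow (U : Matrix.unitaryGroup (κ → ZMod 2) ℂ) (M : Op κ) (k : ℕ) :
    ((U : Op κ).conjTranspose * M * (U : Op κ)) ^ k = (U : Op κ).conjTranspose * M ^ k * U := by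
  induction k with
  | zero => rw [pow_zero, pow_zero, unitary_conj_one]
  | succ k ih => rw [pow_succ, ih, unitary_conj_mul, pow_succ]

lemma IsQubitPair.unitary_conj {A B : Op κ} (h : IsQubitPair A B)
    (U : Matrix.unitaryGroup (κ → ZMod 2) ℂ) :
    IsQubitPair ((U : Op κ).conjTranspose * A * (U : Op κ))
      ((U : Op κ).conjTranspose * B * (U : Op κ)) where
  hermitian_left := by
    simp [Matrix.conjTranspose_mul, h.hermitian_left, mul_assoc]
  hermitian_right := by
    simp [Matrix.conjTranspose_mul, h.hermitian_right, mul_assoc]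
  sq_left := by rw [unitary_conj_mul, h.sq_left, unitary_conj_one]
  sq_right := by rw [unitary_conj_mul, h.sq_right, unitary_conj_one]
  anticomm := by rw [unitary_conj_mul, unitary_conj_mul, h.anticomm]; simp

lemma pauliDecoder_unitary_conj (U : Matrix.unitaryGroup (κ → ZMod 2) ℂ) (A B σ : Op κ) :
    pauliDecoder A B ((U : Op κ) * σ * (U : Op κ).conjTranspose) =
      pauliDecoder ((U : Op κ).conjTranspose * A * (U : Op κ))
        ((U : Op κ).conjTranspose * B * (U : Op κ)) σ := by
  have hhalf : halfProj ((U : Op κ).conjTranspose * B * (U : Op κ)) =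
      (U : Op κ).conjTranspose * halfProj B * U := by
    simp only [halfProj, Matrix.mul_smul, Matrix.smul_mul, mul_add, add_mul, unitary_conj_one]
  ext i j
  rw [pauliDecoder_apply, pauliDecoder_apply, decoderDual, decoderDual, unitary_conj_pow,
    unitary_conj_pow, hhalf, unitary_conj_mul, unitary_conj_mul, mul_assoc, mul_assoc,
    Matrix.trace_mul_comm]
  simp only [mul_assoc]

/-- The Clifford decoders are the decoders of the images of `X` and `Z` on some qubit under a
Clifford unitary. -/
lemma isCliffordDecoder_iff (Φ : Op κ →ₗ[ℂ] QubitOp) :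
    IsCliffordDecoder Φ ↔ ∃ (U : Matrix.unitaryGroup (κ → ZMod 2) ℂ) (o : κ), IsClifford U ∧
      Φ = pauliDecoder ((U : Op κ).conjTranspose * pauliX o * (U : Op κ))
        ((U : Op κ).conjTranspose * pauliZ o * (U : Op κ)) := by
  refine exists_congr fun U => exists_congr fun o => and_congr_right fun _ => ?_
  simp only [partialTrace_eq_pauliDecoder, pauliDecoder_unitary_conj]
  exact ⟨fun h => LinearMap.ext fun σ => Matrix.ext fun i j => h σ i j, fun h σ i j => by rw [h]⟩

lemma isPauli_pauliString (a b : κ → ZMod 2) : IsPauli (pauliString a b) := ⟨0, a, b, by simp⟩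

lemma IsClifford.isPauli_conj {U : Matrix.unitaryGroup (κ → ZMod 2) ℂ} (hU : IsClifford U)
    {M : Op κ} (hM : IsPauli M) : IsPauli ((U : Op κ).conjTranspose * M * (U : Op κ)) := by
  rw [← hU]
  have h : (U : Op κ) * (U : Op κ).conjTranspose = 1 := U.2.2
  have : (U : Op κ) * ((U : Op κ).conjTranspose * M * (U : Op κ)) * (U : Op κ).conjTranspose =
      ((U : Op κ) * (U : Op κ).conjTranspose) * M * ((U : Op κ) * (U : Op κ).conjTranspose) := by
    noncomm_ring
  rwa [this, h, one_mul, mul_one]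

/-- A Clifford decoder outputs a virtual qubit whose `X` and `Z` are Pauli operators. -/
lemma IsCliffordDecoder.exists_isPauli {Φ : Op κ →ₗ[ℂ] QubitOp} (h : IsCliffordDecoder Φ) :
    ∃ A B : Op κ, IsPauli A ∧ IsPauli B ∧ IsQubitPair A B ∧ Φ = pauliDecoder A B := by
  obtain ⟨U, o, hU, rfl⟩ := (isCliffordDecoder_iff Φ).1 h
  exact ⟨_, _, hU.isPauli_conj (isPauli_pauliString _ _), hU.isPauli_conj (isPauli_pauliString _ _),
    (isQubitPair_pauliX_pauliZ o).unitary_conj U, rfl⟩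

end Clifford

/-! ### Decoding from a pair of sets of parties -/

section Pair

variable {n : ℕ} {Q : Type} [Fintype Q] [DecidableEq Q] {owner : Q → Fin n}
  {T T' : Finset (Fin n)}

lemma lift_decoderDual (A B : Op (Share owner T)) (j i : ZMod 2) :
    lift owner T (decoderDual A B j i) =
      decoderDual (lift owner T A) (lift owner T B) j i := by
  simp only [decoderDual, halfProj, map_mul, map_pow, map_smul, map_add, map_one]

lemma IsQubitPair.lift {A B : Op (Share owner T)} (h : IsQubitPair A B) :
    IsQubitPair (lift owner T A) (lift owner T B) where
  hermitian_left := by rw [← lift_conjTranspose, h.hermitian_left]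
  hermitian_right := by rw [← lift_conjTranspose, h.hermitian_right]
  sq_left := by rw [← map_mul, h.sq_left, map_one]
  sq_right := by rw [← map_mul, h.sq_right, map_one]
  anticomm := by rw [← map_mul, h.anticomm, map_neg, map_mul]

lemma pairOutput_pauliDecoder (hT : Disjoint T T') (ρ : Op Q) {N : DecoderFamily owner}
    {A B : Op (Share owner T)} {A' B' : Op (Share owner T')} (hN : N T = pauliDecoder A B)
    (hN' : N T' = pauliDecoder A' B') (i i' j j' : ZMod 2) :
    pairOutput owner ρ N T T' (i, i') (j, j') =
      (ρ * (decoderDual (lift owner T A) (lift owner T B) j i *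
        decoderDual (lift owner T' A') (lift owner T' B') j' i')).trace := by
  rw [pairOutput_apply owner hT ρ N (E := decoderDual A B) (E' := decoderDual A' B')
    (fun σ i j => by rw [hN, pauliDecoder_apply]) (fun σ i j => by rw [hN', pauliDecoder_apply]),
    lift_decoderDual, lift_decoderDual]

/-- Two sets whose joint operators `X X'` and `Z Z'` fix the state decode an EPR pair. -/
lemma pairOutput_eq_epr (hT : Disjoint T T') {ρ : Op Q} (hρ : IsFlatState ρ)
    {N : DecoderFamily owner}
    {A B : Op (Share owner T)} {A' B' : Op (Share owner T')} (hN : N T = pauliDecoder A B)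
    (hN' : N T' = pauliDecoder A' B') (h : IsQubitPair A B) (h' : IsQubitPair A' B')
    (hX : lift owner T A * lift owner T' A' * ρ = ρ)
    (hZ : lift owner T B * lift owner T' B' * ρ = ρ) :
    pairOutput owner ρ N T T' = epr := by
  ext ⟨i, i'⟩ ⟨j, j'⟩
  rw [pairOutput_pauliDecoder hT ρ hN hN']
  exact trace_dual_mul_dual_of_fixes hρ h.lift h'.lift (commute_lift owner hT _ _)
    (commute_lift owner hT _ _) (commute_lift owner hT _ _) (commute_lift owner hT _ _) hX hZ
    _ _ _ _

/-- If two sets decode an EPR pair, then the joint operators `X X'` and `Z Z'` have expectation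
value one in the state, hence fix it. -/
lemma fixes_of_pairOutput_eq_epr (hT : Disjoint T T') {ρ : Op Q} (hρ : IsFlatState ρ)
    {N : DecoderFamily owner}
    {A B : Op (Share owner T)} {A' B' : Op (Share owner T')} (hN : N T = pauliDecoder A B)
    (hN' : N T' = pauliDecoder A' B') (h : IsQubitPair A B) (h' : IsQubitPair A' B')
    (hepr : pairOutput owner ρ N T T' = epr) :
    lift owner T A * lift owner T' A' * ρ = ρ ∧ lift owner T B * lift owner T' B' * ρ = ρ := by
  have hout : ∀ i i' j j', (ρ * (decoderDual (lift owner T A) (lift owner T B) j i *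
        decoderDual (lift owner T' A') (lift owner T' B') j' i')).trace = epr (i, i') (j, j') :=
    fun i i' j j' => by rw [← pairOutput_pauliDecoder hT ρ hN hN', hepr]
  have hinv : ∀ {M : Op (Share owner T)} {M' : Op (Share owner T')}, M * M = 1 → M' * M' = 1 →
      (lift owner T M * lift owner T' M') * (lift owner T M * lift owner T' M') = 1 :=
    fun {M M'} hM hM' => by
      rw [(commute_lift owner hT M M').symm.mul_mul_mul_comm, ← map_mul, ← map_mul, hM, hM']
      simp
  have hherm : ∀ {M : Op (Share owner T)} {M' : Op (Share owner T')}, M.conjTranspose = M →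
      M'.conjTranspose = M' → (lift owner T M * lift owner T' M').conjTranspose =
        lift owner T M * lift owner T' M' := fun {M M'} hM hM' => by
      rw [Matrix.conjTranspose_mul, ← lift_conjTranspose, ← lift_conjTranspose, hM, hM',
        (commute_lift owner hT M M').eq]
  constructor
  · refine hρ.mul_eq_self (hherm h.hermitian_left h'.hermitian_left)
      (hinv h.sq_left h'.sq_left) ?_
    rw [← h.lift.dual_X, ← h'.lift.dual_X]
    simp only [mul_add, add_mul, Matrix.trace_add, hout]
    simp [epr]
    norm_num
  · refine hρ.mul_eq_self (hherm h.hermitian_right h'.hermitian_right)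
      (hinv h.sq_right h'.sq_right) ?_
    rw [← h.lift.dual_Z, ← h'.lift.dual_Z]
    simp only [mul_sub, sub_mul, Matrix.trace_sub, hout]
    simp [epr]
    norm_num

end Pair

/-! ### Hermitian Pauli operators and their restrictions -/

section HermPauli

variable {κ : Type} [Fintype κ] [DecidableEq κ]

/-- The Pauli string with the phase that makes it Hermitian. -/
def hermPauli (a b : κ → ZMod 2) : Op κ := Complex.I ^ (b ⬝ᵥ a).val • pauliString a b

lemma hermPauli_conjTranspose (a b : κ → ZMod 2) :
    (hermPauli a b).conjTranspose = hermPauli a b := by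
  rw [hermPauli, Matrix.conjTranspose_smul, pauliString_conjTranspose, smul_smul]
  rcases zmod_two_cases (b ⬝ᵥ a) with h | h <;> simp [h, ZMod.val_one]

lemma hermPauli_sq (a b : κ → ZMod 2) : hermPauli a b * hermPauli a b = 1 := by
  rw [hermPauli, smul_mul_smul_comm, pauliString_mul, add_self_eq_zero_fun, add_self_eq_zero_fun,
    pauliString_zero, smul_smul]
  rcases zmod_two_cases (b ⬝ᵥ a) with h | h <;> simp [h, ZMod.val_one]

lemma isQubitPair_hermPauli {a b a' b' : κ → ZMod 2} (h : a ⬝ᵥ b' + b ⬝ᵥ a' = 1) {c d : ℂ}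
    (hc : c = 1 ∨ c = -1) (hd : d = 1 ∨ d = -1) :
    IsQubitPair (c • hermPauli a b) (d • hermPauli a' b') where
  hermitian_left := by
    rcases hc with rfl | rfl <;> simp [hermPauli_conjTranspose]
  hermitian_right := by
    rcases hd with rfl | rfl <;> simp [hermPauli_conjTranspose]
  sq_left := by
    rcases hc with rfl | rfl <;> simp [hermPauli_sq]
  sq_right := by
    rcases hd with rfl | rfl <;> simp [hermPauli_sq]
  anticomm := by
    rw [hermPauli, hermPauli, smul_smul, smul_smul, smul_mul_smul_comm, smul_mul_smul_comm,
      pauliString_mul_comm, h, sgn_one, neg_one_smul, smul_neg, mul_comm (c * _)]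

/-- Pauli operators that fix a common nonzero state have vanishing symplectic product. -/
lemma symplectic_eq_zero_of_fixes {ρ : Op κ} (hρ : ρ ≠ 0) {a b a' b' : κ → ZMod 2} {c c' : ℂ}
    (h : (c • pauliString a b) * ρ = ρ) (h' : (c' • pauliString a' b') * ρ = ρ) :
    a ⬝ᵥ b' + b ⬝ᵥ a' = 0 := by
  rw [← sgn_eq_one_iff]
  have hcomm : (c • pauliString a b) * (c' • pauliString a' b') =
      sgn (a ⬝ᵥ b' + b ⬝ᵥ a') • ((c' • pauliString a' b') * (c • pauliString a b)) := by
    rw [smul_mul_smul_comm, smul_mul_smul_comm, pauliString_mul_comm, smul_comm, mul_comm c]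
  have : sgn (a ⬝ᵥ b' + b ⬝ᵥ a') • ρ = (1 : ℂ) • ρ := by
    rw [one_smul]
    calc _ = sgn (a ⬝ᵥ b' + b ⬝ᵥ a') •
          ((c' • pauliString a' b') * (c • pauliString a b)) * ρ := by
          rw [Matrix.smul_mul, mul_assoc, h, h']
      _ = ρ := by rw [← hcomm, mul_assoc, h', h]
  exact smul_left_injective ℂ hρ this

/-- Anticommuting Pauli operators have symplectic product one. -/
lemma symplectic_eq_one_of_isQubitPair {a b a' b' : κ → ZMod 2} {c c' : ℂ}
    (h : IsQubitPair (c • pauliString a b) (c' • pauliString a' b')) :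
    a ⬝ᵥ b' + b ⬝ᵥ a' = 1 := by
  refine (zmod_two_cases _).resolve_left fun h0 => one_ne_zero (α := Op κ) ?_
  have hcomm := pauliString_mul_comm a b a' b'
  rw [h0, sgn_zero, one_smul] at hcomm
  have hanti := h.anticomm
  rw [smul_mul_smul_comm, hcomm, mul_comm, ← smul_mul_smul_comm] at hanti
  have hzero : (c' • pauliString a' b') * (c • pauliString a b) = 0 := by
    ext x y
    exact self_eq_neg.1 (congrFun (congrFun hanti x) y)
  calc 1 = (c' • pauliString a' b') * ((c • pauliString a b) * (c • pauliString a b)) *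
        (c' • pauliString a' b') := by rw [h.sq_left, mul_one, h.sq_right]
    _ = 0 := by rw [← mul_assoc, hzero]; simp

end HermPauli

section Restriction

variable {n : ℕ} {Q : Type} [Fintype Q] [DecidableEq Q] {owner : Q → Fin n}

lemma lift_injective (T : Finset (Fin n)) : Function.Injective (lift owner T) := by
  intro M N h
  ext x y
  have := congrFun (congrFun h (extendZero owner T x)) (extendZero owner T y)
  have hx : ∀ x : Share owner T → ZMod 2,
      (fun q : Share owner T => extendZero owner T x q) = x := fun x => by
    funext q; simp [extendZero, q.2]
  simp only [lift_apply, hx] at this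
  rwa [if_pos, if_pos] at this <;>
  · intro q hq
    rw [extendZero_of_notMem owner _ hq, extendZero_of_notMem owner _ hq]

lemma isQubitPair_of_lift {T : Finset (Fin n)} {A B : Op (Share owner T)}
    (h : IsQubitPair (lift owner T A) (lift owner T B)) : IsQubitPair A B where
  hermitian_left := lift_injective T (by rw [lift_conjTranspose, h.hermitian_left])
  hermitian_right := lift_injective T (by rw [lift_conjTranspose, h.hermitian_right])
  sq_left := lift_injective T (by rw [map_mul, h.sq_left, map_one])
  sq_right := lift_injective T (by rw [map_mul, h.sq_right, map_one])
  anticomm := lift_injective T (by rw [map_mul, h.anticomm, map_neg, map_mul])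

/-- The restriction of a label to the shares of `R`. -/
abbrev res (owner : Q → Fin n) (R : Finset (Fin n)) (a : Q → ZMod 2) : Share owner R → ZMod 2 :=
  fun q => a q

lemma extendZero_add_compl (R : Finset (Fin n)) (a : Q → ZMod 2) :
    extendZero owner R (res owner R a) + extendZero owner Rᶜ (res owner Rᶜ a) = a := by
  funext q
  by_cases h : owner q ∈ R <;> simp [extendZero, h]

/-- A Pauli operator that fixes a state factors, up to signs, into Hermitian Pauli operators on the
shares of `R` and on the shares of the complement. -/
lemma exists_split_of_fixes {ρ : Op Q} (hρ : ρ ≠ 0) {a b : Q → ZMod 2} {c : ℂ}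
    (h : (c • pauliString a b) * ρ = ρ) (R : Finset (Fin n)) :
    ∃ d : ℂ, (d = 1 ∨ d = -1) ∧
      lift owner R ((1 : ℂ) • hermPauli (res owner R a) (res owner R b)) *
        lift owner Rᶜ (d • hermPauli (res owner Rᶜ a) (res owner Rᶜ b)) * ρ = ρ := by
  set P := lift owner R (hermPauli (res owner R a) (res owner R b)) with hP
  set P' := lift owner Rᶜ (hermPauli (res owner Rᶜ a) (res owner Rᶜ b)) with hP'
  have hcomm : Commute P P' := commute_lift owner disjoint_compl_right _ _
  have hsq : (P * P') * (P * P') = 1 := by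
    rw [hcomm.symm.mul_mul_mul_comm, hP, hP', ← map_mul, ← map_mul, hermPauli_sq, hermPauli_sq]
    simp
  have hprod : ∃ e : ℂ, e ≠ 0 ∧ P * P' = e • pauliString a b := by
    refine ⟨_, ?_, by
      rw [hP, hP', hermPauli, hermPauli, map_smul, map_smul, lift_pauliString, lift_pauliString,
        smul_mul_smul_comm, pauliString_mul, extendZero_add_compl, extendZero_add_compl, smul_smul]⟩
    simp [sgn]
  obtain ⟨e, he, hPe⟩ := hprod
  have hfix : (c / e) • (P * P') * ρ = ρ := by
    rw [hPe, smul_smul, div_mul_cancel₀ _ he, h]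
  have hd : (c / e) * (c / e) = 1 := by
    have : ((c / e) * (c / e)) • ρ = (1 : ℂ) • ρ := by
      calc _ = ((c / e) * (c / e)) • ((P * P') * (P * P')) * ρ := by rw [hsq]; simp
        _ = (c / e) • (P * P') * ((c / e) • (P * P') * ρ) := by
          rw [← smul_mul_smul_comm, mul_assoc]
        _ = (1 : ℂ) • ρ := by rw [hfix, hfix, one_smul]
    exact smul_left_injective ℂ hρ this
  refine ⟨c / e, mul_self_eq_one_iff.1 hd, ?_⟩
  rwa [one_smul, map_smul, Matrix.mul_smul]

end Restriction

/-! ### Necessity of the combinatorial conditions -/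

section Necessity

variable {n : ℕ} {Q : Type} [Fintype Q] [DecidableEq Q] {owner : Q → Fin n}

lemma IsStabilizerState.isFlatState {ρ : Op Q} (h : IsStabilizerState ρ) (h0 : ρ ≠ 0) :
    IsFlatState ρ := by
  obtain ⟨G, -, P, hP, hP2, -, rfl⟩ := h
  have htr : P.trace ≠ 0 := fun h => h0 (by simp [h])
  have hreal : star P.trace = P.trace := by rw [← Matrix.trace_conjTranspose, hP]
  refine ⟨?_, ?_, P.trace⁻¹, ?_⟩
  · rw [Matrix.conjTranspose_smul, hP, star_inv₀, hreal]
  · rw [Matrix.trace_smul, smul_eq_mul, inv_mul_cancel₀ htr]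
  · rw [smul_mul_smul_comm, hP2, smul_smul]

/-- By maximality, every pair of disjoint sets that obtains EPR pairs through decoders compatible
with the given ones is authorized. -/
lemma IsMaximal.mem_of_fixes {ρ : Op Q} (hρ : IsFlatState ρ) {N : DecoderFamily owner}
    {𝒜 : Set (Sym2 (Finset (Fin n)))} (h𝒜 : PairsDisjoint 𝒜)
    (hN : ∀ T ∈ flattening 𝒜, IsChannel (N T)) (hdist : Distills owner ρ N 𝒜)
    (hmax : IsMaximal owner ρ N 𝒜) {T T' : Finset (Fin n)} (hT : Disjoint T T')
    (M : DecoderFamily owner) (hM : ∀ R ∈ flattening 𝒜, M R = N R)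
    {A B : Op (Share owner T)} {A' B' : Op (Share owner T')} (hMT : M T = pauliDecoder A B)
    (hMT' : M T' = pauliDecoder A' B') (h : IsQubitPair A B) (h' : IsQubitPair A' B')
    (hX : lift owner T A * lift owner T' A' * ρ = ρ)
    (hZ : lift owner T B * lift owner T' B' * ρ = ρ) : s(T, T') ∈ 𝒜 := by
  by_contra hmem
  refine hmax ⟨insert s(T, T') 𝒜, M, Set.ssubset_insert hmem, ?_, ?_, hM, ?_⟩
  · intro S S' hS
    rcases hS with hS | hS
    · rcases Sym2.eq_iff.1 hS with ⟨rfl, rfl⟩ | ⟨rfl, rfl⟩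
      exacts [hT, hT.symm]
    · exact h𝒜 S S' hS
  · rintro S ⟨S', hS | hS⟩
    · rcases Sym2.eq_iff.1 hS with ⟨rfl, rfl⟩ | ⟨rfl, rfl⟩
      · rw [hMT]; exact h.isChannel
      · rw [hMT']; exact h'.isChannel
    · rw [hM S ⟨S', hS⟩]; exact hN S ⟨S', hS⟩
  · intro S S' hS
    rcases hS with hS | hS
    · rcases Sym2.eq_iff.1 hS with ⟨rfl, rfl⟩ | ⟨rfl, rfl⟩
      · exact pairOutput_eq_epr hT hρ hMT hMT' h h' hX hZ
      · exact pairOutput_eq_epr hT.symm hρ hMT' hMT h' h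
          (by rw [(commute_lift owner hT A A').symm.eq, hX])
          (by rw [(commute_lift owner hT B B').symm.eq, hZ])
    · rw [pairOutput, hM S ⟨S', hS⟩, hM S' ⟨S, Sym2.eq_swap ▸ hS⟩]
      exact hdist S S' hS

/-- The logical operators of a Clifford decoder, as Pauli operators on the whole register. -/
lemma IsCliffordDecoder.exists_logical {T : Finset (Fin n)} {Φ : Op (Share owner T) →ₗ[ℂ] QubitOp}
    (h : IsCliffordDecoder Φ) :
    ∃ (A B : Op (Share owner T)) (a b a' b' : Q → ZMod 2) (c c' : ℂ),
      Φ = pauliDecoder A B ∧ IsQubitPair A B ∧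
      lift owner T A = c • pauliString a b ∧ lift owner T B = c' • pauliString a' b' ∧
      ∀ q, owner q ∉ T → a q = 0 ∧ b q = 0 ∧ a' q = 0 ∧ b' q = 0 := by
  obtain ⟨A, B, ⟨k, a, b, hA⟩, ⟨k', a', b', hB⟩, hAB, hΦ⟩ := h.exists_isPauli
  refine ⟨A, B, extendZero owner T a, extendZero owner T b, extendZero owner T a',
    extendZero owner T b', Complex.I ^ k, Complex.I ^ k', hΦ, hAB, ?_, ?_, fun q hq => ?_⟩
  · rw [hA, map_smul, lift_pauliString]
  · rw [hB, map_smul, lift_pauliString]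
  · simp [extendZero_of_notMem owner _ hq]

/-- A maximal realization forces the combinatorial conditions. The vector `u p q` collects, party by
party, the symplectic product of the logical `X` of `p` with the logical `Z` of `q`. -/
theorem combinatorial_of_realization {ρ : Op Q} (hρ : IsFlatState ρ) {N : DecoderFamily owner}
    {𝒜 : Set (Sym2 (Finset (Fin n)))} (h𝒜 : PairsDisjoint 𝒜)
    (hN : ∀ T ∈ flattening 𝒜, IsCliffordDecoder (N T)) (hdist : Distills owner ρ N 𝒜)
    (hmax : IsMaximal owner ρ N 𝒜) :
    NoOddCycles 𝒜 ∧ Transitivity 𝒜 ∧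
      ∃ u : flattening 𝒜 → flattening 𝒜 → Fin n → ZMod 2, ∀ C, IsSolution 𝒜 C u := by
  have hlog := fun p : flattening 𝒜 => (hN p.1 p.2).exists_logical
  choose A B a b a' b' c c' hdec hpair hA hB hsupp using hlog
  have hchan : ∀ T ∈ flattening 𝒜, IsChannel (N T) := fun T hT => by
    rw [hdec ⟨T, hT⟩]; exact (hpair ⟨T, hT⟩).isChannel
  set X := fun p : flattening 𝒜 => lift owner p.1 (A p) with hXdef
  set Z := fun p : flattening 𝒜 => lift owner p.1 (B p) with hZdef
  have hedge : ∀ p q, (authGraph 𝒜).Adj p q → X p * X q * ρ = ρ ∧ Z p * Z q * ρ = ρ :=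
    fun p q hpq => fixes_of_pairOutput_eq_epr (h𝒜 _ _ hpq.2) hρ (hdec p) (hdec q) (hpair p)
      (hpair q) (hdist _ _ hpq.2)
  -- The logical operators of intermediate vertices square to one, so they cancel along a walk.
  have hwalk : ∀ {p q} (_ : (authGraph 𝒜).Walk p q), X p * X q * ρ = ρ ∧ Z p * Z q * ρ = ρ := by
    intro p q w
    induction w with
    | nil =>
      exact ⟨by rw [(hpair _).lift.sq_left, one_mul], by rw [(hpair _).lift.sq_right, one_mul]⟩
    | @cons p v q h w ih =>
      constructor
      · calc X p * X q * ρ = X p * (X v * X v) * X q * ρ := by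
              rw [(hpair v).lift.sq_left, mul_one]
          _ = X p * X v * (X v * X q * ρ) := by simp only [mul_assoc]
          _ = ρ := by rw [ih.1, (hedge _ _ h).1]
      · calc Z p * Z q * ρ = Z p * (Z v * Z v) * Z q * ρ := by
              rw [(hpair v).lift.sq_right, mul_one]
          _ = Z p * Z v * (Z v * Z q * ρ) := by simp only [mul_assoc]
          _ = ρ := by rw [ih.2, (hedge _ _ h).2]
  have hXX : ∀ p r, (authGraph 𝒜).Reachable p r →
      ∃ d : ℂ, (d • pauliString (a p + a r) (b p + b r)) * ρ = ρ := fun p r ⟨w⟩ => by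
    refine ⟨c p * c r * sgn (b p ⬝ᵥ a r), Eq.trans ?_ (hwalk w).1⟩
    rw [hXdef]
    simp only [hA]
    rw [smul_mul_smul_comm, pauliString_mul, smul_smul]
  have hZZ : ∀ p r, (authGraph 𝒜).Reachable p r →
      ∃ d : ℂ, (d • pauliString (a' p + a' r) (b' p + b' r)) * ρ = ρ := fun p r ⟨w⟩ => by
    refine ⟨c' p * c' r * sgn (b' p ⬝ᵥ a' r), Eq.trans ?_ (hwalk w).2⟩
    rw [hZdef]
    simp only [hB]
    rw [smul_mul_smul_comm, pauliString_mul, smul_smul]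
  -- The symplectic product of the logical `X` of `p` with the logical `Z` of `q`, and its part on
  -- the qubits of the parties in `R`.
  let f : flattening 𝒜 → flattening 𝒜 → Q → ZMod 2 := fun p q r => a p r * b' q r + b p r * a' q r
  let u : flattening 𝒜 → flattening 𝒜 → Fin n → ZMod 2 := fun p q t =>
    ∑ r, if owner r = t then f p q r else 0
  have hu : ∀ (R : Finset (Fin n)) p q,
      ∑ t ∈ R, u p q t = ∑ r, if owner r ∈ R then f p q r else 0 :=
    fun R p q => by
      simp only [u]
      rw [Finset.sum_comm]
      exact Finset.sum_congr rfl fun r _ => by simp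
  have huniv : ∀ p q, ∑ t, u p q t = ∑ r, f p q r := fun p q => by
    rw [hu Finset.univ]; simp
  have hbilin : ∀ p r q s (i : Q),
      (a p + a r) i * (b' q + b' s) i + (b p + b r) i * (a' q + a' s) i =
      f p q i + f p s i + f r q i + f r s i := fun p r q s i => by
    simp only [f, Pi.add_apply]; ring
  have hrel : ∀ p r q s, (authGraph 𝒜).Reachable p r → (authGraph 𝒜).Reachable q s →
      ∑ t, u p q t + ∑ t, u p s t + ∑ t, u r q t + ∑ t, u r s t = 0 := by
    intro p r q s hpr hqs
    obtain ⟨d, hd⟩ := hXX p r hpr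
    obtain ⟨d', hd'⟩ := hZZ q s hqs
    have := symplectic_eq_zero_of_fixes hρ.ne_zero hd hd'
    simp only [dotProduct] at this
    rw [← Finset.sum_add_distrib] at this
    simp only [hbilin, Finset.sum_add_distrib] at this
    simpa only [huniv] using this
  have hdiag : ∀ p, ∑ t, u p p t = 1 := fun p => by
    have := (hpair p).lift
    rw [hA, hB] at this
    have hsymp := symplectic_eq_one_of_isQubitPair this
    simp only [dotProduct] at hsymp
    rwa [← Finset.sum_add_distrib, ← huniv] at hsymp
  have hadj : ∀ p q, (authGraph 𝒜).Adj p q → ∑ t, u p q t = 0 := fun p q h => by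
    rw [huniv]
    refine Finset.sum_eq_zero fun r _ => ?_
    by_cases hr : owner r ∈ p.1
    · have := hsupp q r (Finset.disjoint_left.1 (h𝒜 _ _ h.2) hr)
      simp [f, this]
    · simp [f, hsupp p r hr]
  -- Each edge changes the parity, because its ends are disjoint.
  have hlen : ∀ {p q} (w : (authGraph 𝒜).Walk p q), ∑ t, u p q t = 1 + (w.length : ZMod 2) := by
    intro p q w
    induction w with
    | nil => simp [hdiag]
    | @cons p v q h w ih =>
      have := hrel p v q v h.reachable w.reachable.symm
      rw [hadj p v h, hdiag, ih] at this
      rw [SimpleGraph.Walk.length_cons]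
      push_cast
      have h2 : (2 : ZMod 2) = 0 := rfl
      linear_combination this - h2 * (2 + (w.length : ZMod 2))
  refine ⟨?_, ?_, u, fun C => ⟨?_, ?_, ?_⟩⟩
  · intro p w _ hodd
    have := hlen w
    rw [hdiag, (ZMod.natCast_eq_one_iff_odd).2 hodd] at this
    exact absurd this (by decide)
  · intro p q w _ _ hpq
    exact hmax.mem_of_fixes hρ h𝒜 hchan hdist hpq N (fun _ _ => rfl) (hdec p) (hdec q) (hpair p)
      (hpair q) (hwalk w).1 (hwalk w).2
  · intro p _ q _ t ht
    rw [Finset.mem_inter]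
    by_contra hcon
    refine ht (Finset.sum_eq_zero fun r _ => ?_)
    split_ifs with hr
    · subst hr
      rw [not_and_or] at hcon
      rcases hcon with hcon | hcon
      · simp [f, hsupp p r hcon]
      · simp [f, hsupp q r hcon]
    · rfl
  · intro p hp q hq
    have hreach : (authGraph 𝒜).Reachable p q :=
      SimpleGraph.ConnectedComponent.exact (hp.trans hq.symm)
    constructor
    · intro h
      obtain ⟨w⟩ := hreach
      refine ⟨w, ?_⟩
      rw [hlen w] at h
      rw [← ZMod.natCast_eq_zero_iff_even]
      simpa using h
    · rintro ⟨w, hw⟩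
      rw [hlen w, (ZMod.natCast_eq_zero_iff_even).2 hw, add_zero]
  · intro R hR p hp q hq r hr s hs
    have hpr : (authGraph 𝒜).Reachable p r :=
      SimpleGraph.ConnectedComponent.exact (hp.trans hr.symm)
    have hqs : (authGraph 𝒜).Reachable q s :=
      SimpleGraph.ConnectedComponent.exact (hq.trans hs.symm)
    by_contra hne
    have hone := (zmod_two_cases _).resolve_left hne
    have hall : ∑ t, (u p q t + u p s t + u r q t + u r s t) = 0 := by
      simpa only [Finset.sum_add_distrib] using hrel p r q s hpr hqs
    have hone' : ∑ t ∈ Rᶜ, (u p q t + u p s t + u r q t + u r s t) = 1 := by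
      rw [← Finset.sum_add_sum_compl R, hone] at hall
      rw [← CharTwo.add_eq_zero.1 hall]
    -- The restrictions to `R` and to its complement both form virtual qubits, so `R` and `Rᶜ` could
    -- decode an EPR pair.
    obtain ⟨d, hd⟩ := hXX p r hpr
    obtain ⟨d', hd'⟩ := hZZ q s hqs
    obtain ⟨e, he, hX⟩ := exists_split_of_fixes (owner := owner) hρ.ne_zero hd R
    obtain ⟨e', he', hZ⟩ := exists_split_of_fixes (owner := owner) hρ.ne_zero hd' R
    have hsymp : ∀ S : Finset (Fin n), ∑ t ∈ S, (u p q t + u p s t + u r q t + u r s t) = 1 →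
        res owner S (a p + a r) ⬝ᵥ res owner S (b' q + b' s) +
          res owner S (b p + b r) ⬝ᵥ res owner S (a' q + a' s) = 1 := by
      intro S hS
      simp only [dotProduct]
      rw [← Finset.sum_add_distrib]
      simp only [hbilin]
      rw [sum_share owner S (fun i => f p q i + f p s i + f r q i + f r s i), ← hS]
      simp only [Finset.sum_add_distrib, hu]
      simp only [← Finset.sum_add_distrib]
      exact Finset.sum_congr rfl fun i _ => by split_ifs <;> simp
    by_cases hRc : Rᶜ ∈ flattening 𝒜
    · -- The complement has its own decoder, and a partner inside `R`, whose operators `R` uses.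
      obtain ⟨T', hT'⟩ := hRc
      have hT'mem : T' ∈ flattening 𝒜 := ⟨Rᶜ, Sym2.eq_swap ▸ hT'⟩
      have hsub : T' ⊆ R := by
        have := (h𝒜 _ _ hT')
        intro t ht
        by_contra htR
        exact Finset.disjoint_left.1 this (Finset.mem_compl.2 htR) ht
      set p' : flattening 𝒜 := ⟨T', hT'mem⟩
      set q' : flattening 𝒜 := ⟨Rᶜ, T', hT'⟩
      obtain ⟨hX', hZ'⟩ := fixes_of_pairOutput_eq_epr (h𝒜 _ _ hT').symm hρ (hdec p') (hdec q')
        (hpair p') (hpair q') (hdist _ _ (Sym2.eq_swap ▸ hT'))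
      have hres : ∀ x : Q → ZMod 2, (∀ i, owner i ∉ T' → x i = 0) →
          extendZero owner R (res owner R x) = x := fun x hx =>
        extendZero_restrict owner fun i hi => hx i fun h => hi (hsub h)
      have hAR : lift owner R (c p' • pauliString (res owner R (a p')) (res owner R (b p'))) =
          lift owner T' (A p') := by
        rw [map_smul, lift_pauliString, hA p', hres _ fun i hi => (hsupp p' i hi).1,
          hres _ fun i hi => (hsupp p' i hi).2.1]
      have hBR : lift owner R (c' p' • pauliString (res owner R (a' p')) (res owner R (b' p'))) =
          lift owner T' (B p') := by
        rw [map_smul, lift_pauliString, hB p', hres _ fun i hi => (hsupp p' i hi).2.2.1,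
          hres _ fun i hi => (hsupp p' i hi).2.2.2]
      refine hR ⟨Rᶜ, hmax.mem_of_fixes hρ h𝒜 hchan hdist disjoint_compl_right
        (Function.update N R (pauliDecoder
          (c p' • pauliString (res owner R (a p')) (res owner R (b p')))
          (c' p' • pauliString (res owner R (a' p')) (res owner R (b' p')))))
        (fun S hS => Function.update_of_ne (fun h : S = R => hR (h ▸ hS)) _ _)
        (Function.update_self ..)
        ((Function.update_of_ne (fun h : Rᶜ = R => hR (by simpa only [q', h] using q'.2))
          _ _).trans (hdec q'))
        (isQubitPair_of_lift (by rw [hAR, hBR]; exact (hpair p').lift)) (hpair q')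
        (by rw [hAR]; exact hX') (by rw [hBR]; exact hZ')⟩
    · have hne' : Rᶜ ≠ R := by
        intro h
        have h1 := disjoint_compl_right (a := R)
        rw [h, disjoint_self, Finset.bot_eq_empty] at h1
        rw [h1, Finset.sum_empty] at hone
        exact zero_ne_one hone
      refine hR ⟨Rᶜ, hmax.mem_of_fixes hρ h𝒜 hchan hdist disjoint_compl_right
        (Function.update (Function.update N R
          (pauliDecoder ((1 : ℂ) • hermPauli (res owner R (a p + a r)) (res owner R (b p + b r)))
            ((1 : ℂ) • hermPauli (res owner R (a' q + a' s)) (res owner R (b' q + b' s))))) Rᶜ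
          (pauliDecoder (e • hermPauli (res owner Rᶜ (a p + a r)) (res owner Rᶜ (b p + b r)))
            (e' • hermPauli (res owner Rᶜ (a' q + a' s)) (res owner Rᶜ (b' q + b' s)))))
        (fun S hS => ?_) ?_ (Function.update_self ..)
        (isQubitPair_hermPauli (hsymp R hone) (Or.inl rfl) (Or.inl rfl))
        (isQubitPair_hermPauli (hsymp Rᶜ hone') he he') hX hZ⟩
      · rw [Function.update_of_ne (fun h : S = Rᶜ => hRc (h ▸ hS)),
          Function.update_of_ne (fun h : S = R => hR (h ▸ hS))]
      · rw [Function.update_of_ne hne'.symm, Function.update_self]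

end Necessity

/-! ### CSS states -/

section CSS

variable {κ : Type} [Fintype κ] [DecidableEq κ] (A B : Submodule (ZMod 2) (κ → ZMod 2))

/-- The label `x` satisfies all parity checks in `B`. -/
def Checks (x : κ → ZMod 2) : Prop := ∀ b ∈ B, b ⬝ᵥ x = 0

open scoped Classical in
/-- The projection onto the common `+1` eigenspace of the operators `X ^ a` with `a ∈ A` and
`Z ^ b` with `b ∈ B`, for `A` orthogonal to `B`. -/
def cssProj : Op κ := Matrix.of fun x y => if x + y ∈ A ∧ Checks B y then (Nat.card A : ℂ)⁻¹ else 0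

lemma pauliString_mul_apply (a b : κ → ZMod 2) (M : Op κ) (x y : κ → ZMod 2) :
    (pauliString a b * M) x y = sgn (b ⬝ᵥ (x + a)) * M (x + a) y := by
  rw [Matrix.mul_apply, Finset.sum_eq_single (x + a)]
  · rw [pauliString_apply, if_pos (by rw [add_assoc, add_self_eq_zero_fun, add_zero])]
  · intro z _ hz
    rw [pauliString_apply, if_neg, zero_mul]
    rintro rfl
    exact hz (by rw [add_assoc, add_self_eq_zero_fun, add_zero])
  · simp

lemma pauliString_mulVec_apply (a b : κ → ZMod 2) (v : (κ → ZMod 2) → ℂ) (x : κ → ZMod 2) :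
    (pauliString a b).mulVec v x = sgn (b ⬝ᵥ (x + a)) * v (x + a) := by
  rw [Matrix.mulVec, dotProduct, Finset.sum_eq_single (x + a)]
  · rw [pauliString_apply, if_pos (by rw [add_assoc, add_self_eq_zero_fun, add_zero])]
  · intro z _ hz
    rw [pauliString_apply, if_neg, zero_mul]
    rintro rfl
    exact hz (by rw [add_assoc, add_self_eq_zero_fun, add_zero])
  · simp

variable {A B}

lemma Checks.add {x y : κ → ZMod 2} (hx : Checks B x) (hy : Checks B y) : Checks B (x + y) :=
  fun b hb => by rw [dotProduct_add, hx b hb, hy b hb, add_zero]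

lemma checks_of_add_mem (hAB : ∀ a ∈ A, Checks B a) {x y : κ → ZMod 2} (h : x + y ∈ A)
    (hy : Checks B y) : Checks B x := by
  have := (hAB _ h).add hy
  rwa [add_assoc, add_self_eq_zero_fun, add_zero] at this

lemma cssProj_conjTranspose (hAB : ∀ a ∈ A, Checks B a) :
    (cssProj A B).conjTranspose = cssProj A B := by
  classical
  ext x y
  have h : (y + x ∈ A ∧ Checks B x) ↔ (x + y ∈ A ∧ Checks B y) := by
    constructor <;> rintro ⟨h1, h2⟩ <;> rw [add_comm] at h1
    · exact ⟨h1, checks_of_add_mem hAB (by rwa [add_comm]) h2⟩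
    · exact ⟨h1, checks_of_add_mem hAB (by rwa [add_comm]) h2⟩
  simp only [Matrix.conjTranspose_apply, cssProj, Matrix.of_apply, h]
  split_ifs <;> simp

lemma pauliString_mul_cssProj (hAB : ∀ a ∈ A, Checks B a) {a b : κ → ZMod 2} (ha : a ∈ A)
    (hb : b ∈ B) : pauliString a b * cssProj A B = cssProj A B := by
  classical
  ext x y
  rw [pauliString_mul_apply]
  simp only [cssProj, Matrix.of_apply]
  have h : x + a + y ∈ A ↔ x + y ∈ A := by
    rw [add_right_comm]; exact A.add_mem_iff_left ha
  rw [h]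
  split_ifs with hxy
  · rw [(checks_of_add_mem hAB (h.2 hxy.1) hxy.2) b hb, sgn_zero, one_mul]
  · rw [mul_zero]

/-- Vectors fixed by all stabilizers lie in the range of the projection: such a vector is invariant
under translation by `A` and supported on the labels that satisfy the checks. -/
lemma cssProj_mulVec {v : (κ → ZMod 2) → ℂ}
    (hv : ∀ a ∈ A, ∀ b ∈ B, (pauliString a b).mulVec v = v) : (cssProj A B).mulVec v = v := by
  classical
  have hA : ∀ a ∈ A, ∀ x, v (x + a) = v x := fun a ha x => by
    have := congrFun (hv a ha 0 B.zero_mem) x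
    rwa [pauliString_mulVec_apply, zero_dotProduct, sgn_zero, one_mul] at this
  have hB : ∀ x, ¬ Checks B x → v x = 0 := fun x hx => by
    simp only [Checks, not_forall] at hx
    obtain ⟨b, hb, hbx⟩ := hx
    have := congrFun (hv 0 A.zero_mem b hb) x
    rw [pauliString_mulVec_apply, add_zero, (zmod_two_cases _).resolve_left hbx, sgn_one,
      neg_one_mul, neg_eq_self] at this
    exact this
  funext x
  have hcard : (Nat.card A : ℂ) ≠ 0 := Nat.cast_ne_zero.2 Nat.card_pos.ne'
  have hterm : ∀ y, cssProj A B x y * v y = if x + y ∈ A then (Nat.card A : ℂ)⁻¹ * v x else 0 := by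
    intro y
    simp only [cssProj, Matrix.of_apply]
    by_cases hxy : x + y ∈ A
    · have hvy : v y = v x := by
        rw [← hA _ hxy y, add_comm x y, ← add_assoc, add_self_eq_zero_fun, zero_add]
      by_cases hy : Checks B y
      · simp [hxy, hy, hvy]
      · simp [hxy, hy, ← hvy, hB y hy]
    · simp [hxy]
  rw [Matrix.mulVec, dotProduct, Finset.sum_congr rfl fun y _ => hterm y, ← Finset.sum_filter,
    Finset.sum_const, nsmul_eq_mul, ← mul_assoc]
  have hc : (Finset.univ.filter fun y => x + y ∈ A).card = Nat.card A := by
    rw [Nat.card_eq_fintype_card, Fintype.card_subtype]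
    refine Finset.card_equiv (Equiv.addLeft x) fun y => by simp
  rw [hc, mul_inv_cancel₀ hcard, one_mul]

lemma cssProj_sq (hAB : ∀ a ∈ A, Checks B a) : cssProj A B * cssProj A B = cssProj A B := by
  ext x y
  refine congrFun (cssProj_mulVec (v := fun z => cssProj A B z y) fun a ha b hb => ?_) x
  funext z
  exact congrFun (congrFun (pauliString_mul_cssProj hAB ha hb) z) y

variable (A B) in
/-- The maximally mixed state on the CSS code of `A` and `B`. -/
def cssState : Op κ := (cssProj A B).trace⁻¹ • cssProj A B

/-- The operators `X ^ a * Z ^ b` with `a ∈ A` and `b ∈ B`. -/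
def cssGroup (hAB : ∀ a ∈ A, Checks B a) : Subgroup (Matrix.unitaryGroup (κ → ZMod 2) ℂ) where
  carrier := {U | ∃ a ∈ A, ∃ b ∈ B, (U : Op κ) = pauliString a b}
  one_mem' := ⟨0, A.zero_mem, 0, B.zero_mem, pauliString_zero.symm⟩
  mul_mem' := by
    rintro U V ⟨a, ha, b, hb, hU⟩ ⟨a', ha', b', hb', hV⟩
    refine ⟨a + a', A.add_mem ha ha', b + b', B.add_mem hb hb', ?_⟩
    rw [Submonoid.coe_mul, hU, hV, pauliString_mul, hAB a' ha' b hb, sgn_zero, one_smul]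
  inv_mem' := by
    rintro U ⟨a, ha, b, hb, hU⟩
    refine ⟨a, ha, b, hb, ?_⟩
    change (U : Op κ).conjTranspose = _
    rw [hU, pauliString_conjTranspose, hAB a ha b hb, sgn_zero, one_smul]

lemma pauliString_mem_unitaryGroup (a b : κ → ZMod 2) :
    pauliString a b ∈ Matrix.unitaryGroup (κ → ZMod 2) ℂ := by
  rw [Matrix.mem_unitaryGroup_iff]
  change pauliString a b * (pauliString a b).conjTranspose = 1
  rw [pauliString_conjTranspose, Matrix.mul_smul, pauliString_mul, smul_smul, sgn_mul_self,
    one_smul, add_self_eq_zero_fun, add_self_eq_zero_fun, pauliString_zero]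

lemma isStabilizerState_cssState (hAB : ∀ a ∈ A, Checks B a) :
    IsStabilizerState (cssState A B) := by
  refine ⟨cssGroup hAB, ⟨?_, ?_, ?_⟩, cssProj A B, cssProj_conjTranspose hAB, cssProj_sq hAB,
    ?_, rfl⟩
  · rintro U ⟨a, -, b, -, hU⟩
    rw [hU]
    exact isPauli_pauliString a b
  · rintro U ⟨a, ha, b, hb, hU⟩ V ⟨a', ha', b', hb', hV⟩
    apply Subtype.ext
    rw [Submonoid.coe_mul, Submonoid.coe_mul, hU, hV, pauliString_mul_comm, dotProduct_comm a b',
      hAB a ha b' hb', hAB a' ha' b hb, add_zero, sgn_zero, one_smul]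
  · rintro U ⟨a, ha, b, hb, hU⟩ c hc
    rw [hU] at hc
    have h := congrFun (congrFun hc a) 0
    rw [pauliString_apply, if_pos (zero_add a).symm, dotProduct_zero, sgn_zero, Matrix.smul_apply,
      Matrix.one_apply, smul_eq_mul] at h
    split_ifs at h
    · rw [mul_one] at h; exact h.symm
    · rw [mul_zero] at h; exact absurd h one_ne_zero
  · intro v
    constructor
    · rintro hv U ⟨a, ha, b, hb, hU⟩
      rw [hU, ← hv, Matrix.mulVec_mulVec, pauliString_mul_cssProj hAB ha hb]
    · intro hv
      exact cssProj_mulVec fun a ha b hb =>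
        hv ⟨_, pauliString_mem_unitaryGroup a b⟩ ⟨a, ha, b, hb, rfl⟩

open scoped ComplexOrder in
lemma isFlatState_cssState (hAB : ∀ a ∈ A, Checks B a) : IsFlatState (cssState A B) := by
  classical
  refine (isStabilizerState_cssState hAB).isFlatState fun h => ?_
  have hP : cssProj A B ≠ 0 := fun h => by
    have := congrFun (congrFun h 0) 0
    simp [cssProj, Checks, A.zero_mem] at this
  rcases smul_eq_zero.1 h with h | h
  · rw [inv_eq_zero] at h
    apply hP
    rw [← Matrix.trace_conjTranspose_mul_self_eq_zero_iff, cssProj_conjTranspose hAB,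
      cssProj_sq hAB, h]
  · exact hP h

lemma pauliString_mul_cssState (hAB : ∀ a ∈ A, Checks B a) {a b : κ → ZMod 2} (ha : a ∈ A)
    (hb : b ∈ B) : pauliString a b * cssState A B = cssState A B := by
  rw [cssState, Matrix.mul_smul, pauliString_mul_cssProj hAB ha hb]

end CSS

/-! ### Clifford decoders of CSS type -/

section CSSDecoder

variable {κ : Type} [Fintype κ] [DecidableEq κ]

/-- The unitary that permutes the computational basis by a linear automorphism. -/
def permUnitary (L : (κ → ZMod 2) ≃ₗ[ZMod 2] (κ → ZMod 2)) :
    Matrix.unitaryGroup (κ → ZMod 2) ℂ :=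
  ⟨(1 : Op κ).submatrix L.symm id, by
    rw [Matrix.mem_unitaryGroup_iff]
    change _ * ((1 : Op κ).submatrix L.symm id).conjTranspose = 1
    ext x y
    simp [Matrix.mul_apply, Matrix.one_apply]⟩

lemma permUnitary_conj_apply (L : (κ → ZMod 2) ≃ₗ[ZMod 2] (κ → ZMod 2)) (M : Op κ)
    (x y : κ → ZMod 2) :
    ((permUnitary L : Op κ) * M * (permUnitary L : Op κ).conjTranspose) x y =
      M (L.symm x) (L.symm y) := by
  simp [permUnitary, Matrix.mul_apply, Matrix.one_apply]

lemma permUnitary_conjTranspose (L : (κ → ZMod 2) ≃ₗ[ZMod 2] (κ → ZMod 2)) :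
    (permUnitary L : Op κ).conjTranspose = (permUnitary L.symm : Op κ) := by
  ext x y
  simp only [permUnitary, Matrix.conjTranspose_apply, Matrix.submatrix_apply, Matrix.one_apply, id,
    LinearEquiv.symm_symm]
  have : L.symm y = x ↔ L x = y := by rw [LinearEquiv.symm_apply_eq, eq_comm]
  simp only [this]
  split_ifs <;> simp

lemma exists_dotProduct_comp (L : (κ → ZMod 2) →ₗ[ZMod 2] (κ → ZMod 2)) (b : κ → ZMod 2) :
    ∃ b', ∀ y, b ⬝ᵥ L y = b' ⬝ᵥ y := by
  refine ⟨Matrix.vecMul b (LinearMap.toMatrix' L), fun y => ?_⟩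
  rw [← Matrix.dotProduct_mulVec, LinearMap.toMatrix'_mulVec]

lemma permUnitary_conj_pauliString (L : (κ → ZMod 2) ≃ₗ[ZMod 2] (κ → ZMod 2))
    (a b b' : κ → ZMod 2) (hb : ∀ y, b ⬝ᵥ L.symm y = b' ⬝ᵥ y) :
    (permUnitary L : Op κ) * pauliString a b * (permUnitary L : Op κ).conjTranspose =
      pauliString (L a) b' := by
  ext x y
  rw [permUnitary_conj_apply, pauliString_apply, pauliString_apply, hb]
  have : L.symm x = L.symm y + a ↔ x = y + L a := by
    rw [LinearEquiv.symm_apply_eq, map_add, LinearEquiv.apply_symm_apply]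
  simp only [this]

lemma isPauli_permUnitary_conj (L : (κ → ZMod 2) ≃ₗ[ZMod 2] (κ → ZMod 2)) {M : Op κ}
    (hM : IsPauli M) :
    IsPauli ((permUnitary L : Op κ) * M * (permUnitary L : Op κ).conjTranspose) := by
  obtain ⟨k, a, b, rfl⟩ := hM
  obtain ⟨b', hb'⟩ := exists_dotProduct_comp L.symm.toLinearMap b
  exact ⟨k, L a, b', by
    rw [Matrix.mul_smul, Matrix.smul_mul, permUnitary_conj_pauliString L a b b' hb']⟩

lemma isClifford_permUnitary (L : (κ → ZMod 2) ≃ₗ[ZMod 2] (κ → ZMod 2)) :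
    IsClifford (permUnitary L) := by
  refine fun M => ⟨fun h => ?_, isPauli_permUnitary_conj L⟩
  have := isPauli_permUnitary_conj L.symm h
  convert this using 1
  ext x y
  rw [permUnitary_conj_apply, permUnitary_conj_apply]
  simp

/-- If `a ⬝ b = 1`, the virtual qubit with Pauli operators `X ^ a` and `Z ^ b` can be decoded by a
Clifford unitary: a linear automorphism of the basis labels that sends `a` to a basis vector `e_o`
and pulls the coordinate `o` back to the functional `b`. -/
lemma isCliffordDecoder_pauliDecoder {a b : κ → ZMod 2} (hab : b ⬝ᵥ a = 1) :
    IsCliffordDecoder (pauliDecoder (pauliString a 0) (pauliString 0 b)) := by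
  obtain ⟨o, ho⟩ : ∃ o, b o = 1 := by
    by_contra! h
    have : b = 0 := funext fun q => (zmod_two_cases _).resolve_right (h q)
    simp [this] at hab
  let L₀ : (κ → ZMod 2) →ₗ[ZMod 2] (κ → ZMod 2) :=
    { toFun := fun x q => if q = o then b ⬝ᵥ x else x q + a q * (b ⬝ᵥ x)
      map_add' := fun x y => by
        funext q
        simp only [Pi.add_apply, dotProduct_add]
        split_ifs <;> ring
      map_smul' := fun c x => by
        funext q
        simp only [Pi.smul_apply, dotProduct_smul, smul_eq_mul, RingHom.id_apply]
        split_ifs <;> ring }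
  have hL₀ : ∀ x q, L₀ x q = if q = o then b ⬝ᵥ x else x q + a q * (b ⬝ᵥ x) := fun _ _ => rfl
  have hinj : Function.Injective L₀ := by
    rw [← LinearMap.ker_eq_bot, LinearMap.ker_eq_bot']
    intro x hx
    have h0 : b ⬝ᵥ x = 0 := by simpa [hL₀] using congrFun hx o
    have hq : ∀ q, q ≠ o → x q = 0 := fun q hq => by simpa [hL₀, hq, h0] using congrFun hx q
    have hxo : x o = 0 := by
      rw [dotProduct, Finset.sum_eq_single o (fun q _ h => by rw [hq q h, mul_zero]) (by simp),
        ho, one_mul] at h0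
      exact h0
    funext q
    by_cases h : q = o
    · rw [h, hxo]; rfl
    · exact hq q h
  let L := LinearEquiv.ofInjectiveEndo L₀ hinj
  have hL : ∀ x, L x = L₀ x := fun x => rfl
  have hLa : L.symm (Pi.single o 1) = a := by
    rw [LinearEquiv.symm_apply_eq, hL]
    funext q
    rw [hL₀, hab]
    by_cases h : q = o
    · subst h; simp
    · simp [h, CharTwo.add_self_eq_zero]
  refine (isCliffordDecoder_iff _).2 ⟨permUnitary L, o, isClifford_permUnitary L, ?_⟩
  have hconj : ∀ M, (permUnitary L : Op κ).conjTranspose * M * (permUnitary L : Op κ) =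
      (permUnitary L.symm : Op κ) * M * (permUnitary L.symm : Op κ).conjTranspose := fun M => by
    rw [permUnitary_conjTranspose L.symm, permUnitary_conjTranspose L, LinearEquiv.symm_symm]
  rw [hconj, hconj, permUnitary_conj_pauliString L.symm _ 0 0 (by simp), hLa,
    permUnitary_conj_pauliString L.symm 0 _ b (fun y => by
      rw [LinearEquiv.symm_symm, hL]; simp [hL₀]), map_zero]

end CSSDecoder

/-! ### Separable states have EPR fidelity at most one half -/

section Separable

open scoped ComplexOrder

/-- Twice the fidelity of a product state `S ⊗ S'` with the EPR pair is at most its trace, by the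
nonnegativity of the two determinants. -/
lemma re_sum_mul_le_of_posSemidef {S S' : QubitOp} (hS : S.PosSemidef) (hS' : S'.PosSemidef) :
    (∑ i, ∑ j, S i j * S' i j).re ≤ (S.trace * S'.trace).re := by
  have key : ∀ {S : QubitOp}, S.PosSemidef → (S 0 0).im = 0 ∧ (S 1 1).im = 0 ∧ 0 ≤ (S 0 0).re ∧
      0 ≤ (S 1 1).re ∧ S 1 0 = star (S 0 1) ∧
      (S 0 1).re ^ 2 + (S 0 1).im ^ 2 ≤ (S 0 0).re * (S 1 1).re := by
    intro S hS
    have h0 := Complex.le_def.1 (hS.diag_nonneg (i := 0))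
    have h1 := Complex.le_def.1 (hS.diag_nonneg (i := 1))
    have h01 : S 1 0 = star (S 0 1) := by rw [← Matrix.conjTranspose_apply, hS.1]
    have hdet : 0 ≤ S 0 0 * S 1 1 - S 0 1 * S 1 0 := by
      have := hS.det_nonneg
      rwa [show S.det = S 0 0 * S 1 1 - S 0 1 * S 1 0 from Matrix.det_fin_two S] at this
    have hd := (Complex.le_def.1 hdet).1
    simp only [Complex.zero_re, Complex.zero_im] at h0 h1
    refine ⟨h0.2.symm, h1.2.symm, h0.1, h1.1, h01, ?_⟩
    rw [h01] at hd
    simp [← h0.2] at hd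
    nlinarith
  obtain ⟨a1, a2, a3, a4, a5, a6⟩ := key hS
  obtain ⟨b1, b2, b3, b4, b5, b6⟩ := key hS'
  simp only [sum_zmod_two, Matrix.trace, Matrix.diag_apply, a5, b5]
  simp only [Complex.add_re, Complex.mul_re, Complex.add_im, a1, a2, b1, b2, Complex.star_def,
    Complex.conj_re, Complex.conj_im]
  set p := (S 0 0).re
  set q := (S 1 1).re
  set x := (S 0 1).re
  set y := (S 0 1).im
  set p' := (S' 0 0).re
  set q' := (S' 1 1).re
  set x' := (S' 0 1).re
  set y' := (S' 0 1).im
  have hsq : (2 * (x * x' - y * y')) ^ 2 ≤ (p * q' + q * p') ^ 2 := by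
    have h1 : (x * x' - y * y') ^ 2 ≤ (x ^ 2 + y ^ 2) * (x' ^ 2 + y' ^ 2) := by
      nlinarith [sq_nonneg (x * y' + y * x')]
    have h2 : (x ^ 2 + y ^ 2) * (x' ^ 2 + y' ^ 2) ≤ (p * q) * (p' * q') :=
      mul_le_mul a6 b6 (by positivity) (by positivity)
    nlinarith [sq_nonneg (p * q' - q * p')]
  have := abs_le_of_sq_le_sq hsq (by positivity)
  linarith [(abs_le.1 this).2]

variable {α α' : Type} [Fintype α] [DecidableEq α] [Fintype α'] [DecidableEq α']

lemma IsChannel.posSemidef {Φ : Matrix α α ℂ →ₗ[ℂ] QubitOp} (h : IsChannel Φ)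
    {σ : Matrix α α ℂ} (hσ : σ.PosSemidef) : (Φ σ).PosSemidef := by
  obtain ⟨r, K, -, hK⟩ := h
  rw [hK]
  exact Matrix.posSemidef_sum _ fun i _ => hσ.mul_mul_conjTranspose_same _

lemma IsChannel.trace_apply {Φ : Matrix α α ℂ →ₗ[ℂ] QubitOp} (h : IsChannel Φ)
    (σ : Matrix α α ℂ) : (Φ σ).trace = σ.trace := by
  obtain ⟨r, K, hK1, hK⟩ := h
  rw [hK, Matrix.trace_sum]
  conv_rhs => rw [← one_mul σ, ← hK1, Matrix.sum_mul, Matrix.trace_sum]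
  exact Finset.sum_congr rfl fun i _ => by rw [Matrix.trace_mul_comm, Matrix.mul_assoc]

lemma eprFidelity_eq (σ : Matrix (ZMod 2 × ZMod 2) (ZMod 2 × ZMod 2) ℂ) :
    eprFidelity σ = (1 / 2 : ℝ) * (∑ i, ∑ j, σ (i, i) (j, j)).re := by
  have : (σ * epr).trace = (1 / 2 : ℝ) * ∑ i, ∑ j, σ (i, i) (j, j) := by
    simp only [Matrix.trace, Matrix.diag_apply, Matrix.mul_apply, Fintype.sum_prod_type,
      sum_zmod_two, epr, Matrix.of_apply]
    simp
    ring
  rw [eprFidelity, this, Complex.re_ofReal_mul]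

/-- The tensor product of two maps acts on a sum of product operators factor by factor. -/
lemma tensorApply_apply (Φ : Matrix α α ℂ →ₗ[ℂ] QubitOp) (Ψ : Matrix α' α' ℂ →ₗ[ℂ] QubitOp)
    {ι : Type} [Fintype ι] (r : ℂ) (S : ι → Matrix α α ℂ) (S' : ι → Matrix α' α' ℂ)
    {σ : Matrix (α × α') (α × α') ℂ}
    (hσ : ∀ x x' y y', σ (x, x') (y, y') = r * ∑ k, S k x y * S' k x' y') (i i' j j' : ZMod 2) :
    tensorApply Φ Ψ σ (i, i') (j, j') = r * ∑ k, Φ (S k) i j * Ψ (S' k) i' j' := by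
  have hexp : ∀ {α : Type} [Fintype α] [DecidableEq α] (Φ : Matrix α α ℂ →ₗ[ℂ] QubitOp)
      (S : Matrix α α ℂ) (i j : ZMod 2),
      Φ S i j = ∑ x, ∑ y, S x y * Φ (Matrix.single x y 1) i j := by
    intro α _ _ Φ S i j
    conv_lhs => rw [Matrix.matrix_eq_sum_single S]
    simp only [map_sum, Matrix.sum_apply]
    refine Finset.sum_congr rfl fun x _ => Finset.sum_congr rfl fun y _ => ?_
    rw [← mul_one (S x y), ← smul_eq_mul, ← Matrix.smul_single, map_smul]
    simp
  simp only [tensorApply, Matrix.sum_apply, Matrix.smul_apply, Matrix.kroneckerMap_apply, hσ,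
    smul_eq_mul]
  have hk : ∀ k, Φ (S k) i j * Ψ (S' k) i' j' = ∑ x, ∑ y, ∑ x', ∑ y',
      S k x y * S' k x' y' * (Φ (Matrix.single x y 1) i j * Ψ (Matrix.single x' y' 1) i' j') := by
    intro k
    rw [hexp Φ, hexp Ψ]
    simp only [Finset.sum_mul]
    simp only [Finset.mul_sum]
    refine Finset.sum_congr rfl fun x _ => Finset.sum_congr rfl fun y _ =>
      Finset.sum_congr rfl fun x' _ => Finset.sum_congr rfl fun y' _ => ?_
    ring
  simp only [hk]
  simp only [Finset.mul_sum, Finset.sum_mul]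
  conv_rhs => rw [Finset.sum_comm]
  refine Finset.sum_congr rfl fun x _ => ?_
  conv_rhs => rw [Finset.sum_comm]
  refine Finset.sum_congr rfl fun y _ => ?_
  conv_rhs => rw [Finset.sum_comm]
  refine Finset.sum_congr rfl fun x' _ => ?_
  conv_rhs => rw [Finset.sum_comm]
  refine Finset.sum_congr rfl fun y' _ => Finset.sum_congr rfl fun k _ => ?_
  ring

/-- Local channels applied to a separable state of trace one produce a state whose fidelity with
the EPR pair is at most one half. -/
theorem eprFidelity_tensorApply_le_half {Φ : Matrix α α ℂ →ₗ[ℂ] QubitOp}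
    {Ψ : Matrix α' α' ℂ →ₗ[ℂ] QubitOp} (hΦ : IsChannel Φ) (hΨ : IsChannel Ψ)
    {ι : Type} [Fintype ι] (r : ℂ) (φ : ι → α → ℂ) (φ' : ι → α' → ℂ)
    {σ : Matrix (α × α') (α × α') ℂ}
    (hσ : ∀ x x' y y', σ (x, x') (y, y') =
      r * ∑ k, (φ k x * star (φ k y)) * (φ' k x' * star (φ' k y')))
    (htr : σ.trace = 1) : eprFidelity (tensorApply Φ Ψ σ) ≤ 1 / 2 := by
  set S : ι → Matrix α α ℂ := fun k => Matrix.vecMulVec (φ k) (star (φ k)) with hS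
  set S' : ι → Matrix α' α' ℂ := fun k => Matrix.vecMulVec (φ' k) (star (φ' k)) with hS'
  have hSpos : ∀ k, (S k).PosSemidef := fun k => Matrix.posSemidef_vecMulVec_self_star _
  have hSpos' : ∀ k, (S' k).PosSemidef := fun k => Matrix.posSemidef_vecMulVec_self_star _
  set τ : ℂ := ∑ k, (S k).trace * (S' k).trace with hτ
  have hτ0 : 0 ≤ τ := Finset.sum_nonneg fun k _ =>
    mul_nonneg (hSpos k).trace_nonneg (hSpos' k).trace_nonneg
  have hrτ : r * τ = 1 := by
    rw [← htr, hτ]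
    simp only [Matrix.trace, Matrix.diag_apply, Fintype.sum_prod_type, hσ, Finset.sum_mul,
      Finset.mul_sum]
    rw [Finset.sum_comm]
    conv_lhs => enter [2, x]; rw [Finset.sum_comm]
    simp only [hS, hS', Matrix.vecMulVec_apply, Pi.star_apply]
    exact Finset.sum_comm
  have hτr : τ = (τ.re : ℂ) := by
    apply Complex.ext
    · simp
    · simpa using (Complex.le_def.1 hτ0).2.symm
  have hτne : τ.re ≠ 0 := fun h => by
    rw [hτr, h] at hrτ; simp at hrτ
  have hτpos : 0 < τ.re := lt_of_le_of_ne (Complex.le_def.1 hτ0).1 (Ne.symm hτne)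
  have hr : r = ((τ.re)⁻¹ : ℝ) := by
    rw [Complex.ofReal_inv, ← hτr]
    exact eq_inv_of_mul_eq_one_left hrτ
  rw [eprFidelity_eq]
  have hsum : ∑ i, ∑ j, tensorApply Φ Ψ σ (i, i) (j, j) =
      r * ∑ k, ∑ i, ∑ j, Φ (S k) i j * Ψ (S' k) i j := by
    simp only [tensorApply_apply Φ Ψ r S S' hσ, ← Finset.mul_sum]
    congr 1
    simp only [sum_zmod_two, ← Finset.sum_add_distrib]
  rw [hsum, hr, Complex.re_ofReal_mul, Complex.re_sum]
  have hle : ∑ k, (∑ i, ∑ j, Φ (S k) i j * Ψ (S' k) i j).re ≤ τ.re := by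
    rw [hτ, Complex.re_sum]
    refine Finset.sum_le_sum fun k _ => ?_
    rw [← hΦ.trace_apply, ← hΨ.trace_apply]
    exact re_sum_mul_le_of_posSemidef (hΦ.posSemidef (hSpos k)) (hΨ.posSemidef (hSpos' k))
  have := mul_le_mul_of_nonneg_left hle (inv_nonneg.2 hτpos.le)
  rw [inv_mul_cancel₀ hτne, ← Complex.re_sum] at this
  rw [← Complex.re_sum]
  linarith

end Separable

/-! ### Separability of CSS states across a cut -/

section CSSSeparable

variable {n : ℕ} {Q : Type} [Fintype Q] [DecidableEq Q] {owner : Q → Fin n}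

/-- The part of a label on the qubits of the parties in `R`. -/
def mask (owner : Q → Fin n) (R : Finset (Fin n)) : (Q → ZMod 2) →ₗ[ZMod 2] (Q → ZMod 2) where
  toFun x q := if owner q ∈ R then x q else 0
  map_add' x y := by funext q; simp only [Pi.add_apply]; split_ifs <;> simp
  map_smul' c x := by funext q; simp

lemma mask_apply (R : Finset (Fin n)) (x : Q → ZMod 2) (q : Q) :
    mask owner R x q = if owner q ∈ R then x q else 0 := rfl

lemma mask_add_mask_compl (R : Finset (Fin n)) (x : Q → ZMod 2) :
    mask owner R x + mask owner Rᶜ x = x := by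
  funext q
  by_cases h : owner q ∈ R <;> simp [mask_apply, h]

lemma mask_mask (R : Finset (Fin n)) (x : Q → ZMod 2) :
    mask owner R (mask owner R x) = mask owner R x := by
  funext q; simp only [mask_apply]; split_ifs <;> rfl

lemma mask_mask_compl (R : Finset (Fin n)) (x : Q → ZMod 2) :
    mask owner R (mask owner Rᶜ x) = 0 := by
  funext q
  by_cases h : owner q ∈ R <;> simp [mask_apply, h]

lemma mask_compl_mask (R : Finset (Fin n)) (x : Q → ZMod 2) :
    mask owner Rᶜ (mask owner R x) = 0 := by
  funext q
  by_cases h : owner q ∈ R <;> simp [mask_apply, h]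

lemma dotProduct_mask (R : Finset (Fin n)) (x y : Q → ZMod 2) :
    x ⬝ᵥ mask owner R y = ∑ q, if owner q ∈ R then x q * y q else 0 := by
  simp [dotProduct, mask_apply]

/-- A label outside `A` is detected by a parity check that vanishes on `A`. -/
lemma exists_dotProduct_of_notMem {A : Submodule (ZMod 2) (Q → ZMod 2)} {z : Q → ZMod 2}
    (hz : z ∉ A) : ∃ χ, Checks A χ ∧ χ ⬝ᵥ z = 1 := by
  obtain ⟨f, hf, hfA⟩ := Submodule.exists_dual_map_eq_bot_of_notMem hz inferInstance
  have hdot : ∀ x, (fun q => f (Pi.single q 1)) ⬝ᵥ x = f x := fun x => by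
    conv_rhs => rw [pi_eq_sum_univ' x, map_sum]
    simp only [dotProduct, map_smul, smul_eq_mul]
    exact Finset.sum_congr rfl fun q _ => mul_comm _ _
  refine ⟨fun q => f (Pi.single q 1), fun a ha => ?_, ?_⟩
  · rw [dotProduct_comm, hdot]
    have : f a ∈ A.map f := Submodule.mem_map_of_mem ha
    rwa [hfA, Submodule.mem_bot] at this
  · rw [hdot]
    exact (zmod_two_cases _).resolve_left hf

open scoped Classical in
/-- Orthogonality of characters: the annihilator of `A` detects membership in `A`. -/
lemma sum_sgn_checks (A : Submodule (ZMod 2) (Q → ZMod 2)) (z : Q → ZMod 2) :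
    (∑ χ, if Checks A χ then sgn (χ ⬝ᵥ z) else 0) =
      if z ∈ A then ((Finset.univ.filter fun χ => Checks A χ).card : ℂ) else 0 := by
  split_ifs with hz
  · rw [Finset.card_filter, Nat.cast_sum]
    refine Finset.sum_congr rfl fun χ _ => ?_
    split_ifs with hχ
    · rw [dotProduct_comm, hχ z hz]; simp
    · simp
  · obtain ⟨χ₀, h₀, h₁⟩ := exists_dotProduct_of_notMem hz
    have : (∑ χ, if Checks A χ then sgn (χ ⬝ᵥ z) else 0) =
        -(∑ χ, if Checks A χ then sgn (χ ⬝ᵥ z) else 0) := by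
      conv_lhs => rw [← Equiv.sum_comp (Equiv.addLeft χ₀)]
      rw [← Finset.sum_neg_distrib]
      refine Finset.sum_congr rfl fun χ _ => ?_
      have hiff : Checks A (χ₀ + χ) ↔ Checks A χ := by
        refine ⟨fun h => ?_, h₀.add⟩
        have := h₀.add h
        rwa [← add_assoc, add_self_eq_zero_fun, zero_add] at this
      simp only [Equiv.coe_addLeft, hiff, add_dotProduct, sgn_add, h₁, sgn_one]
      split_ifs <;> simp
    exact self_eq_neg.1 this

open scoped Classical in
/-- If the `X`-type and the `Z`-type stabilizers commute already on the qubits of `R`, the CSS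
projection is a sum of product operators across the cut between `R` and its complement. The
vectors are indexed by a coset representative `v` and a character `χ`; the support of each vector
is a coset of the sum of the two local parts of `A`, which is a product set. -/
lemma exists_product_decomposition {A B : Submodule (ZMod 2) (Q → ZMod 2)}
    (hAB : ∀ a ∈ A, Checks B a) (R : Finset (Fin n))
    (hR : ∀ a ∈ A, Checks B (mask owner R a)) :
    ∃ (r : ℂ) (α α' : (Q → ZMod 2) × (Q → ZMod 2) → (Q → ZMod 2) → ℂ),
      (∀ k x y, (∀ q, owner q ∈ R → x q = y q) → α k x = α k y) ∧
      (∀ k x y, (∀ q, owner q ∉ R → x q = y q) → α' k x = α' k y) ∧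
      ∀ x y, cssState A B x y =
        r * ∑ k, (α k x * α' k x) * star (α k y * α' k y) := by
  let D₁ := A.map (mask owner R)
  let D₂ := A.map (mask owner Rᶜ)
  let D := D₁ ⊔ D₂
  have hD : ∀ x, x ∈ D ↔ mask owner R x ∈ D₁ ∧ mask owner Rᶜ x ∈ D₂ := by
    intro x
    constructor
    · intro hx
      obtain ⟨_, ⟨a, ha, rfl⟩, _, ⟨a', ha', rfl⟩, rfl⟩ := Submodule.mem_sup.1 hx
      have h2 := mask_mask (owner := owner) Rᶜ a'
      have h3 := mask_mask_compl (owner := owner) R a'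
      refine ⟨⟨a, ha, ?_⟩, ⟨a', ha', ?_⟩⟩
      · rw [map_add, mask_mask, h3, add_zero]
      · rw [map_add, mask_compl_mask, h2, zero_add]
    · rintro ⟨h1, h2⟩
      rw [← mask_add_mask_compl (owner := owner) R x]
      exact Submodule.add_mem_sup h1 h2
  have hAD : A ≤ D := fun a ha => (hD a).2 ⟨⟨a, ha, rfl⟩, ⟨a, ha, rfl⟩⟩
  have hDB : ∀ d ∈ D, Checks B d := by
    intro d hd
    obtain ⟨_, ⟨a, ha, rfl⟩, _, ⟨a', ha', rfl⟩, rfl⟩ := Submodule.mem_sup.1 hd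
    refine (hR a ha).add ?_
    have : mask owner Rᶜ a' = a' + mask owner R a' := by
      conv_rhs => rw [← mask_add_mask_compl (owner := owner) R a']
      rw [map_add, mask_mask, mask_mask_compl, add_zero, add_right_comm, add_self_eq_zero_fun,
        zero_add]
    rw [this]
    exact (hAB a' ha').add (hR a' ha')
  let α : (Q → ZMod 2) × (Q → ZMod 2) → (Q → ZMod 2) → ℂ := fun k x =>
    if Checks B k.1 ∧ Checks A k.2 ∧ mask owner R (x + k.1) ∈ D₁ then
      sgn (k.2 ⬝ᵥ mask owner R x) else 0
  let α' : (Q → ZMod 2) × (Q → ZMod 2) → (Q → ZMod 2) → ℂ := fun k x =>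
    if mask owner Rᶜ (x + k.1) ∈ D₂ then sgn (k.2 ⬝ᵥ mask owner Rᶜ x) else 0
  have hprod : ∀ k x, α k x * α' k x =
      if Checks B k.1 ∧ Checks A k.2 ∧ x + k.1 ∈ D then sgn (k.2 ⬝ᵥ x) else 0 := by
    intro k x
    have hs : sgn (k.2 ⬝ᵥ x) = sgn (k.2 ⬝ᵥ mask owner R x) * sgn (k.2 ⬝ᵥ mask owner Rᶜ x) := by
      rw [← sgn_add, ← dotProduct_add, mask_add_mask_compl]
    simp only [α, α', hD, hs, ite_zero_mul_ite_zero, and_assoc]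
  let cD : ℂ := Nat.card D
  let cA : ℂ := ((Finset.univ.filter fun χ : Q → ZMod 2 => Checks A χ).card : ℂ)
  have hcD : cD ≠ 0 := Nat.cast_ne_zero.2 Nat.card_pos.ne'
  have hcA : cA ≠ 0 := Nat.cast_ne_zero.2
    (Finset.card_pos.2 ⟨0, Finset.mem_filter.2
      ⟨Finset.mem_univ _, fun a _ => dotProduct_zero a⟩⟩).ne'
  have hsum : ∀ x y, ∑ k, (α k x * α' k x) * star (α k y * α' k y) =
      if x + y ∈ A ∧ Checks B y then cD * cA else 0 := by
    intro x y
    have hsplit : ∑ k, (α k x * α' k x) * star (α k y * α' k y) =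
        (∑ v, if Checks B v ∧ x + v ∈ D ∧ y + v ∈ D then 1 else 0) *
          ∑ χ, if Checks A χ then sgn (χ ⬝ᵥ (x + y)) else 0 := by
      rw [Fintype.sum_prod_type, Finset.sum_mul_sum]
      refine Finset.sum_congr rfl fun v _ => Finset.sum_congr rfl fun χ _ => ?_
      simp only [hprod, dotProduct_add, sgn_add]
      by_cases h1 : Checks B v <;> by_cases h2 : Checks A χ <;> by_cases h3 : x + v ∈ D <;>
        by_cases h4 : y + v ∈ D <;> simp [h1, h2, h3, h4, -RCLike.star_def, star_sgn]
    rw [hsplit, sum_sgn_checks]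
    by_cases hxy : x + y ∈ A
    · have hv : ∀ v, (Checks B v ∧ x + v ∈ D ∧ y + v ∈ D) ↔ Checks B y ∧ y + v ∈ D := by
        intro v
        have hx : y + v ∈ D → x + v ∈ D := fun h => by
          have := D.add_mem (hAD hxy) h
          rwa [add_assoc, ← add_assoc y, add_self_eq_zero_fun, zero_add] at this
        have hy : y + v ∈ D → (Checks B v ↔ Checks B y) := fun h =>
          ⟨fun hv => checks_of_add_mem hDB h hv,
            fun hy => checks_of_add_mem hDB (by rwa [add_comm]) hy⟩
        tauto
      have hc : (Finset.univ.filter fun v => y + v ∈ D).card = Nat.card D := by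
        rw [Nat.card_eq_fintype_card, Fintype.card_subtype]
        exact Finset.card_equiv (Equiv.addLeft y) fun v => by simp
      simp only [hv, hxy, if_true, true_and]
      by_cases hy : Checks B y
      · simp only [hy, true_and, if_true, Finset.sum_boole, hc, cD, cA]
      · simp [hy]
    · simp [hxy]
  refine ⟨(cssProj A B).trace⁻¹ * ((Nat.card A : ℂ)⁻¹ * (cD * cA)⁻¹), α, α', ?_, ?_, ?_⟩
  · intro k x y h
    have h1 : mask owner R x = mask owner R y := by
      funext q; simp only [mask_apply]; split_ifs with hq; exacts [h q hq, rfl]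
    simp only [α, map_add, h1]
  · intro k x y h
    have h1 : mask owner Rᶜ x = mask owner Rᶜ y := by
      funext q
      simp only [mask_apply, Finset.mem_compl]
      split_ifs with hq
      exacts [rfl, h q hq]
    simp only [α', map_add, h1]
  · intro x y
    rw [hsum]
    simp only [cssState, cssProj, Matrix.smul_apply, Matrix.of_apply, smul_eq_mul]
    split_ifs
    · field_simp
    · simp

/-- A state that is a sum of product operators across a cut separating `T` from `T'` gives
EPR fidelity at most one half. -/
lemma eprFidelity_pairOutput_le_half {T T' : Finset (Fin n)} (hT : Disjoint T T') {ρ : Op Q}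
    (htr : ρ.trace = 1) {M : DecoderFamily owner} (hM : IsChannel (M T)) (hM' : IsChannel (M T'))
    {ι : Type} [Fintype ι] (r : ℂ) (α α' : ι → (Q → ZMod 2) → ℂ)
    (hα : ∀ k x y, (∀ q, owner q ∉ T' → x q = y q) → α k x = α k y)
    (hα' : ∀ k x y, (∀ q, owner q ∉ T → x q = y q) → α' k x = α' k y)
    (hρ : ∀ x y, ρ x y = r * ∑ k, (α k x * α' k x) * star (α k y * α' k y)) :
    eprFidelity (pairOutput owner ρ M T T') ≤ 1 / 2 := by
  refine eprFidelity_tensorApply_le_half hM hM'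
    (ι := ι × (Share owner (T ∪ T')ᶜ → ZMod 2)) r
    (fun k x => α k.1 (glue owner T T' x 0 k.2)) (fun k x' => α' k.1 (glue owner T T' 0 x' k.2))
    ?_ ?_
  · intro x x' y y'
    have h1 : ∀ k x x' e, α k (glue owner T T' x x' e) = α k (glue owner T T' x 0 e) :=
      fun k x x' e => hα k _ _ fun q hq => by simp [glue, hq]
    have h2 : ∀ k x x' e, α' k (glue owner T T' x x' e) = α' k (glue owner T T' 0 x' e) :=
      fun k x x' e => hα' k _ _ fun q hq => by simp [glue, hq]
    simp only [reducedState, Matrix.of_apply, hρ, Fintype.sum_prod_type, ← Finset.mul_sum]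
    rw [Finset.sum_comm]
    congr 1
    refine Finset.sum_congr rfl fun k _ => Finset.sum_congr rfl fun e _ => ?_
    rw [h1 k x x', h1 k y y', h2 k x x', h2 k y y', star_mul']
    ring
  · rw [← htr]
    simp only [Matrix.trace, Matrix.diag_apply]
    rw [← (glueEquiv owner hT).sum_comp fun z => ρ z z]
    simp only [Fintype.sum_prod_type, glueEquiv_apply, reducedState, Matrix.of_apply]

end CSSSeparable

/-! ### Uncorrelated virtual qubits -/

section Uncorrelated

variable {n : ℕ} {Q : Type} [Fintype Q] [DecidableEq Q] {owner : Q → Fin n}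

/-- If the three nontrivial joint Pauli expectation values that define the EPR pair vanish, the
fidelity with the EPR pair is one quarter. -/
lemma eprFidelity_eq_quarter {T T' : Finset (Fin n)} (hT : Disjoint T T') {ρ : Op Q}
    (htr : ρ.trace = 1) {N : DecoderFamily owner}
    {A B : Op (Share owner T)} {A' B' : Op (Share owner T')} (hN : N T = pauliDecoder A B)
    (hN' : N T' = pauliDecoder A' B') (h : IsQubitPair A B) (h' : IsQubitPair A' B')
    (hX : (ρ * (lift owner T A * lift owner T' A')).trace = 0)
    (hZ : (ρ * (lift owner T B * lift owner T' B')).trace = 0)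
    (hY : (ρ *
      (lift owner T B * lift owner T' B' * (lift owner T A * lift owner T' A'))).trace = 0) :
    eprFidelity (pairOutput owner ρ N T T') = 1 / 4 := by
  rw [eprFidelity_eq]
  simp only [pairOutput_pauliDecoder hT ρ hN hN']
  have hA : ∀ M : Op (Share owner T'), Commute (lift owner T A) (lift owner T' M) :=
    fun M => commute_lift owner hT A M
  have hl := h.lift
  have hl' := h'.lift
  set a := lift owner T A
  set b := lift owner T B
  set a' := lift owner T' A'
  set b' := lift owner T' B'
  have hP' : Commute a (halfProj b') := ((Commute.one_right a).add_right (hA B')).smul_right _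
  have hP'' : Commute a (halfProj (-b')) :=
    ((Commute.one_right a).add_right (hA B').neg_right).smul_right _
  have hsum : ∑ i, ∑ j, decoderDual a b j i * decoderDual a' b' j i =
      (1 / 2 : ℂ) • (1 + b * b' + a * a' + b * b' * (a * a')) := by
    simp only [sum_zmod_two, decoderDual_zero_zero, decoderDual_zero_one, decoderDual_one_zero,
      decoderDual_one_one, hl.left_halfProj_left, hl'.left_halfProj_left]
    rw [hl.left_mul_halfProj, hl'.left_mul_halfProj]
    have e1 : halfProj b * a * (halfProj b' * a') = halfProj b * halfProj b' * (a * a') := by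
      rw [mul_assoc, ← mul_assoc a, hP'.eq]; simp only [mul_assoc]
    have e2 : halfProj (-b) * a * (halfProj (-b') * a') =
        halfProj (-b) * halfProj (-b') * (a * a') := by
      rw [mul_assoc, ← mul_assoc a, hP''.eq]; simp only [mul_assoc]
    have e3 : halfProj b * halfProj b' + halfProj (-b) * halfProj (-b') =
        (1 / 2 : ℂ) • (1 + b * b') := by
      simp only [halfProj, smul_mul_smul_comm, ← smul_add]
      rw [show (1 + b) * (1 + b') + (1 + -b) * (1 + -b') = (2 : ℂ) • (1 + b * b') by
        rw [two_smul]; noncomm_ring, smul_smul]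
      norm_num
    calc _ = (halfProj b * halfProj b' + halfProj (-b) * halfProj (-b')) +
          (halfProj b * halfProj b' + halfProj (-b) * halfProj (-b')) * (a * a') := by
          rw [e1, e2, add_mul]; abel
      _ = _ := by
          rw [e3, Matrix.smul_mul, ← smul_add, add_mul, one_mul]
          congr 1; abel
  have htrace : ∑ i, ∑ j, (ρ * (decoderDual a b j i * decoderDual a' b' j i)).trace = 1 / 2 := by
    simp only [← Matrix.trace_sum, ← Finset.mul_sum]
    rw [hsum, Matrix.mul_smul, Matrix.trace_smul, mul_add, mul_add, mul_add, mul_one,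
      Matrix.trace_add, Matrix.trace_add, Matrix.trace_add, hX, hZ, hY, htr]
    norm_num
  rw [htrace]
  norm_num

end Uncorrelated

/-! ### The CSS scheme of a solution of the linear systems -/

section Sufficiency

variable {n : ℕ} {𝒜 : Set (Sym2 (Finset (Fin n)))}

/-- An assignment of vectors to all pairs of vertices that solves the linear systems of all
connected components and vanishes on pairs from different components. -/
structure IsGlobalSolution (𝒜 : Set (Sym2 (Finset (Fin n))))
    (w : flattening 𝒜 → flattening 𝒜 → Fin n → ZMod 2) : Prop where
  support : ∀ p q t, w p q t ≠ 0 → t ∈ p.1 ∧ t ∈ q.1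
  of_not_reachable : ∀ p q, ¬ (authGraph 𝒜).Reachable p q → w p q = 0
  sum_eq : ∀ p q (_ : (authGraph 𝒜).Walk p q) , ∑ t, w p q t = 1 ↔ SameSide (authGraph 𝒜) p q
  local_eq : ∀ R : Finset (Fin n), R ∉ flattening 𝒜 → ∀ p q r s, (authGraph 𝒜).Reachable p q →
    (authGraph 𝒜).Reachable p r → (authGraph 𝒜).Reachable p s →
      ∑ t ∈ R, (w p q t + w p s t + w r q t + w r s t) = 0

lemma exists_isGlobalSolution
    (h : ∀ C : (authGraph 𝒜).ConnectedComponent,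
      ∃ u : flattening 𝒜 → flattening 𝒜 → Fin n → ZMod 2, IsSolution 𝒜 C u) :
    ∃ w, IsGlobalSolution 𝒜 w := by
  classical
  choose u hu using h
  let c := (authGraph 𝒜).connectedComponentMk
  have hc : ∀ {p q}, (authGraph 𝒜).Reachable p q → c q = c p := fun h =>
    (SimpleGraph.ConnectedComponent.sound h).symm
  have hw : ∀ {p q}, (authGraph 𝒜).Reachable p q →
      (if (authGraph 𝒜).Reachable p q then u (c p) p q else 0) = u (c p) p q := fun h => if_pos h
  refine ⟨fun p q => if (authGraph 𝒜).Reachable p q then u (c p) p q else 0, ⟨?_, ?_, ?_, ?_⟩⟩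
  · intro p q t ht
    split_ifs at ht with h
    · exact Finset.mem_inter.1 ((hu (c p)).1 p rfl q (hc h) t ht)
    · exact absurd rfl ht
  · intro p q h
    exact if_neg h
  · intro p q w
    rw [hw w.reachable]
    exact (hu (c p)).2.1 p rfl q (hc w.reachable)
  · intro R hR p q r s hq hr hs
    rw [hw hq, hw hs, hw (hr.symm.trans hq), hw (hr.symm.trans hs), hc hr]
    exact (hu (c p)).2.2 R hR p rfl q (hc hq) r (hc hr) s (hc hs)

namespace IsGlobalSolution

variable {w : flattening 𝒜 → flattening 𝒜 → Fin n → ZMod 2}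

lemma sum_self (h : IsGlobalSolution 𝒜 w) (p) : ∑ t, w p p t = 1 :=
  (h.sum_eq p p .nil).2 ⟨.nil, by simp⟩

lemma sum_of_disjoint (h : IsGlobalSolution 𝒜 w) {p q : flattening 𝒜} (hpq : Disjoint p.1 q.1) :
    ∑ t, w p q t = 0 :=
  Finset.sum_eq_zero fun t _ => by
    by_contra ht
    exact Finset.disjoint_left.1 hpq (h.support p q t ht).1 (h.support p q t ht).2

lemma sum_of_walk (h : IsGlobalSolution 𝒜 w) (hodd : NoOddCycles 𝒜) {p q : flattening 𝒜}
    (v : (authGraph 𝒜).Walk p q) : ∑ t, w p q t = 1 + (v.length : ZMod 2) := by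
  have hiff : ∑ t, w p q t = 1 ↔ Even v.length := (h.sum_eq p q v).trans
    ⟨fun ⟨v', hv'⟩ => (even_length_iff_of_noOddCycles hodd v' v).1 hv', fun hv => ⟨v, hv⟩⟩
  by_cases hv : Even v.length
  · rw [hiff.2 hv, (ZMod.natCast_eq_zero_iff_even).2 hv, add_zero]
  · rw [(ZMod.natCast_eq_one_iff_odd).2 (Nat.not_even_iff_odd.1 hv), CharTwo.add_self_eq_zero]
    exact (zmod_two_cases _).resolve_right fun h1 => hv (hiff.1 h1)

/-- The global commutation relations: with all parties together the parities cancel. -/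
lemma sum_rectangle (h : IsGlobalSolution 𝒜 w) (hodd : NoOddCycles 𝒜) {p q r s : flattening 𝒜}
    (hq : (authGraph 𝒜).Reachable p q) (hr : (authGraph 𝒜).Reachable p r)
    (hs : (authGraph 𝒜).Reachable p s) :
    ∑ t, (w p q t + w p s t + w r q t + w r s t) = 0 := by
  obtain ⟨a⟩ := hq
  obtain ⟨b⟩ := hr.symm
  obtain ⟨c⟩ := hs
  simp only [Finset.sum_add_distrib]
  rw [h.sum_of_walk hodd a, h.sum_of_walk hodd c, h.sum_of_walk hodd (b.append a),
    h.sum_of_walk hodd (b.append c)]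
  simp only [SimpleGraph.Walk.length_append, Nat.cast_add]
  have h2 : (2 : ZMod 2) = 0 := rfl
  linear_combination h2 * (2 + (a.length : ZMod 2) + b.length + c.length)

end IsGlobalSolution

variable (w : flattening 𝒜 → flattening 𝒜 → Fin n → ZMod 2)

/-- Each party holds one qubit for every set that occurs in an authorized pair. -/
abbrev cssOwner (𝒜 : Set (Sym2 (Finset (Fin n)))) : Fin n × flattening 𝒜 → Fin n := Prod.fst

/-- The exponents of the logical `X` of `p`. -/
def logX (p : flattening 𝒜) : Fin n × flattening 𝒜 → ZMod 2 := fun i => w p i.2 i.1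

open scoped Classical in
/-- The exponents of the logical `Z` of `q`: it acts on the qubits with label `q` of the members
of `q`. -/
def logZ (q : flattening 𝒜) : Fin n × flattening 𝒜 → ZMod 2 := fun i =>
  if i.2 = q ∧ i.1 ∈ q.1 then 1 else 0

/-- The `X`-type stabilizers. -/
def stabX : Submodule (ZMod 2) (Fin n × flattening 𝒜 → ZMod 2) :=
  Submodule.span _ {x | ∃ p r, (authGraph 𝒜).Reachable p r ∧ x = logX w p + logX w r}

/-- The `Z`-type stabilizers. -/
def stabZ (𝒜 : Set (Sym2 (Finset (Fin n)))) :
    Submodule (ZMod 2) (Fin n × flattening 𝒜 → ZMod 2) :=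
  Submodule.span _ {x | ∃ q s, (authGraph 𝒜).Reachable q s ∧ x = logZ q + logZ s}

variable {w} [Fintype (flattening 𝒜)]

/-- The symplectic product of the logical `X` of `p` and the logical `Z` of `q` on the qubits of the
parties in `R`. -/
lemma dotProduct_mask_logX (h : IsGlobalSolution 𝒜 w) (R : Finset (Fin n)) (p q : flattening 𝒜) :
    logZ q ⬝ᵥ mask (cssOwner 𝒜) R (logX w p) = ∑ t ∈ R, w p q t := by
  rw [dotProduct_mask, Fintype.sum_prod_type, ← Finset.univ_inter R,
    ← Finset.filter_mem_eq_inter, Finset.sum_filter]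
  refine Finset.sum_congr rfl fun t _ => ?_
  rw [Finset.sum_eq_single q]
  · by_cases ht : t ∈ q.1
    · simp [logZ, logX, cssOwner, ht]
    · have : w p q t = 0 := by
        by_contra hne
        exact ht (h.support _ _ _ hne).2
      simp [logX, cssOwner, this]
  · intro q' _ hq'
    simp [logZ, hq']
  · simp

lemma dotProduct_logX (h : IsGlobalSolution 𝒜 w) (p q : flattening 𝒜) :
    logZ q ⬝ᵥ logX w p = ∑ t, w p q t := by
  rw [← dotProduct_mask_logX h]
  congr 1
  funext i
  simp [mask_apply]

/-- If the rectangle relations hold on the parties in `R`, the `X`-type and the `Z`-type stabilizers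
commute on the qubits of `R`. -/
lemma checks_mask_of_rectangle (h : IsGlobalSolution 𝒜 w) (R : Finset (Fin n))
    (hR : ∀ p q r s, (authGraph 𝒜).Reachable p q →
      (authGraph 𝒜).Reachable p r → (authGraph 𝒜).Reachable p s →
      ∑ t ∈ R, (w p q t + w p s t + w r q t + w r s t) = 0) :
    ∀ a ∈ stabX w, Checks (stabZ 𝒜) (mask (cssOwner 𝒜) R a) := by
  intro a ha b hb
  induction hb using Submodule.span_induction with
  | zero => simp
  | add x y _ _ hx hy => rw [add_dotProduct, hx, hy, add_zero]
  | smul c x _ hx => rw [smul_dotProduct, hx, smul_zero]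
  | mem b hb =>
    obtain ⟨q, s, hqs, rfl⟩ := hb
    induction ha using Submodule.span_induction with
    | zero => simp
    | add x y _ _ hx hy => rw [map_add, dotProduct_add, hx, hy, add_zero]
    | smul c x _ hx => rw [map_smul, dotProduct_smul, hx, smul_zero]
    | mem a ha =>
      obtain ⟨p, r, hpr, rfl⟩ := ha
      simp only [map_add, add_dotProduct, dotProduct_add, dotProduct_mask_logX h]
      by_cases hpq : (authGraph 𝒜).Reachable p q
      · rw [← hR p q r s hpq hpr (hpq.trans hqs)]
        simp only [Finset.sum_add_distrib]
        ring
      · have hrq : ¬ (authGraph 𝒜).Reachable r q := fun h => hpq (hpr.trans h)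
        have hps : ¬ (authGraph 𝒜).Reachable p s := fun h => hpq (h.trans hqs.symm)
        have hrs : ¬ (authGraph 𝒜).Reachable r s := fun h => hps (hpr.trans h)
        simp [h.of_not_reachable _ _ hpq, h.of_not_reachable _ _ hrq, h.of_not_reachable _ _ hps,
          h.of_not_reachable _ _ hrs]

lemma checks_stabX (h : IsGlobalSolution 𝒜 w) (hodd : NoOddCycles 𝒜) :
    ∀ a ∈ stabX w, Checks (stabZ 𝒜) a := by
  have := checks_mask_of_rectangle h Finset.univ fun p q r s => h.sum_rectangle hodd
  intro a ha
  convert this a ha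
  funext i
  simp [mask_apply]

/-- A Pauli operator that anticommutes with a stabilizer has expectation value zero. -/
lemma trace_cssState_mul_pauliString {κ : Type} [Fintype κ] [DecidableEq κ]
    {A B : Submodule (ZMod 2) (κ → ZMod 2)} (hAB : ∀ a ∈ A, Checks B a) {a b x z : κ → ZMod 2}
    (ha : a ∈ A) (hb : b ∈ B) (hab : a ⬝ᵥ z + b ⬝ᵥ x = 1) :
    (cssState A B * pauliString x z).trace = 0 := by
  have hfix := pauliString_mul_cssState hAB ha hb
  refine trace_eq_zero_of_anticomm hfix
    ((isFlatState_cssState hAB).mul_eq_self_right ?_ hfix) ?_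
  · rw [pauliString_conjTranspose, hAB a ha b hb, sgn_zero, one_smul]
  · rw [pauliString_mul_comm, hab, sgn_one, neg_one_smul]

open scoped Classical in
/-- The decoder of `T` outputs the virtual qubit of its logical operators. -/
def cssDecoder (w : flattening 𝒜 → flattening 𝒜 → Fin n → ZMod 2) :
    DecoderFamily (cssOwner 𝒜) := fun T =>
  if hT : T ∈ flattening 𝒜 then
    pauliDecoder (pauliString (res (cssOwner 𝒜) T (logX w ⟨T, hT⟩)) 0)
      (pauliString 0 (res (cssOwner 𝒜) T (logZ ⟨T, hT⟩)))
  else 0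

lemma logX_eq_zero (h : IsGlobalSolution 𝒜 w) (p : flattening 𝒜) (i : Fin n × flattening 𝒜)
    (hi : cssOwner 𝒜 i ∉ p.1) : logX w p i = 0 := by
  by_contra hne
  exact hi (h.support _ _ _ hne).1

lemma logZ_eq_zero (p : flattening 𝒜) (i : Fin n × flattening 𝒜)
    (hi : cssOwner 𝒜 i ∉ p.1) : logZ p i = 0 :=
  if_neg fun h => hi h.2

/-- A solution excludes the degenerate authorized pair `{∅, ∅}`, so authorized pairs are edges. -/
lemma adj_of_mem (h : IsGlobalSolution 𝒜 w) (h𝒜 : PairsDisjoint 𝒜) {p q : flattening 𝒜}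
    (hpq : s(p.1, q.1) ∈ 𝒜) : (authGraph 𝒜).Adj p q := by
  refine ⟨?_, hpq⟩
  rintro rfl
  exact zero_ne_one ((h.sum_of_disjoint (h𝒜 _ _ hpq)).symm.trans (h.sum_self p))

lemma lift_logX (h : IsGlobalSolution 𝒜 w) (p : flattening 𝒜) :
    lift (cssOwner 𝒜) p.1 (pauliString (res (cssOwner 𝒜) p.1 (logX w p)) 0) =
      pauliString (logX w p) 0 := by
  rw [lift_pauliString, extendZero_restrict _ (logX_eq_zero h p)]
  congr 1
  exact extendZero_restrict _ (a := 0) fun _ _ => rfl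

lemma lift_logZ (p : flattening 𝒜) :
    lift (cssOwner 𝒜) p.1 (pauliString 0 (res (cssOwner 𝒜) p.1 (logZ p))) =
      pauliString 0 (logZ p) := by
  rw [lift_pauliString, extendZero_restrict _ (logZ_eq_zero p)]
  congr 1
  exact extendZero_restrict _ (a := 0) fun _ _ => rfl

lemma cssDecoder_eq (p : flattening 𝒜) : cssDecoder w p.1 =
    pauliDecoder (pauliString (res (cssOwner 𝒜) p.1 (logX w p)) 0)
      (pauliString 0 (res (cssOwner 𝒜) p.1 (logZ p))) := dif_pos p.2

lemma dotProduct_res_logX (h : IsGlobalSolution 𝒜 w) (p : flattening 𝒜) :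
    res (cssOwner 𝒜) p.1 (logZ p) ⬝ᵥ res (cssOwner 𝒜) p.1 (logX w p) = 1 := by
  rw [← h.sum_self p, ← dotProduct_logX h]
  simp only [dotProduct]
  rw [sum_share (cssOwner 𝒜) p.1 fun i => logZ p i * logX w p i]
  refine Finset.sum_congr rfl fun i _ => ?_
  split_ifs with hi
  · rfl
  · rw [logX_eq_zero h p i hi, mul_zero]

lemma isQubitPair_res (h : IsGlobalSolution 𝒜 w) (p : flattening 𝒜) :
    IsQubitPair (pauliString (res (cssOwner 𝒜) p.1 (logX w p)) 0)
      (pauliString 0 (res (cssOwner 𝒜) p.1 (logZ p))) :=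
  isQubitPair_pauliString (zero_dotProduct _) (dotProduct_zero _)
    (by rw [dotProduct_comm, dotProduct_res_logX h, zero_dotProduct, add_zero])

lemma add_mem_stabX {p r : flattening 𝒜} (hpr : (authGraph 𝒜).Reachable p r) :
    logX w p + logX w r ∈ stabX w := Submodule.subset_span ⟨_, _, hpr, rfl⟩

lemma add_mem_stabZ {p r : flattening 𝒜} (hpr : (authGraph 𝒜).Reachable p r) :
    logZ p + logZ r ∈ stabZ 𝒜 := Submodule.subset_span ⟨_, _, hpr, rfl⟩

lemma isCliffordDecoder_cssDecoder (h : IsGlobalSolution 𝒜 w) (p : flattening 𝒜) :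
    IsCliffordDecoder (cssDecoder w p.1) := by
  rw [cssDecoder_eq p]
  exact isCliffordDecoder_pauliDecoder (dotProduct_res_logX h p)

lemma pairOutput_cssDecoder (h : IsGlobalSolution 𝒜 w) (h𝒜 : PairsDisjoint 𝒜)
    (hodd : NoOddCycles 𝒜) {p q : flattening 𝒜} (hpq : s(p.1, q.1) ∈ 𝒜) :
    pairOutput (cssOwner 𝒜) (cssState (stabX w) (stabZ 𝒜)) (cssDecoder w) p.1 q.1 = epr := by
  have hAB := checks_stabX h hodd
  have hreach := (adj_of_mem h h𝒜 hpq).reachable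
  refine pairOutput_eq_epr (h𝒜 _ _ hpq) (isFlatState_cssState hAB) (cssDecoder_eq p)
    (cssDecoder_eq q) (isQubitPair_res h p) (isQubitPair_res h q) ?_ ?_
  · rw [lift_logX h p, lift_logX h q, pauliString_mul, zero_dotProduct, sgn_zero, one_smul,
      add_zero]
    exact pauliString_mul_cssState hAB (add_mem_stabX hreach) (Submodule.zero_mem _)
  · rw [lift_logZ p, lift_logZ q, pauliString_mul, dotProduct_zero, sgn_zero, one_smul, add_zero]
    exact pauliString_mul_cssState hAB (Submodule.zero_mem _) (add_mem_stabZ hreach)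

/-- The outputs of disjoint vertices from different components are uncorrelated: every joint
logical operator anticommutes with a stabilizer from the component of the first vertex. -/
lemma eprFidelity_of_not_reachable (h : IsGlobalSolution 𝒜 w) (h𝒜 : PairsDisjoint 𝒜)
    (hodd : NoOddCycles 𝒜) {p q : flattening 𝒜} (hpq : Disjoint p.1 q.1)
    (hnr : ¬ (authGraph 𝒜).Reachable p q) {M : DecoderFamily (cssOwner 𝒜)}
    (hp : M p.1 = cssDecoder w p.1) (hq : M q.1 = cssDecoder w q.1) :
    eprFidelity (pairOutput (cssOwner 𝒜) (cssState (stabX w) (stabZ 𝒜)) M p.1 q.1) = 1 / 4 := by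
  have hAB := checks_stabX h hodd
  obtain ⟨r, hr⟩ : ∃ r : flattening 𝒜, s(p.1, r.1) ∈ 𝒜 := by
    obtain ⟨S, hS⟩ := p.2
    exact ⟨⟨S, p.1, Sym2.eq_swap ▸ hS⟩, hS⟩
  have hreach := (adj_of_mem h h𝒜 hr).reachable
  have hdisj := h𝒜 _ _ hr
  have hrq : ¬ (authGraph 𝒜).Reachable r q := fun h => hnr (hreach.trans h)
  have hzero : ∀ {p q : flattening 𝒜}, ¬ (authGraph 𝒜).Reachable p q →
      ∑ t, w p q t = 0 := fun hpq => by simp [h.of_not_reachable _ _ hpq]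
  have hXq : (logZ p + logZ r) ⬝ᵥ (logX w p + logX w q) = 1 := by
    simp only [add_dotProduct, dotProduct_add, dotProduct_logX h]
    rw [h.sum_self, hzero fun h => hnr h.symm, hzero fun h => hrq h.symm, h.sum_of_disjoint hdisj]
    simp
  have hZq : (logX w p + logX w r) ⬝ᵥ (logZ p + logZ q) = 1 := by
    rw [dotProduct_comm]
    simp only [add_dotProduct, dotProduct_add, dotProduct_logX h]
    rw [h.sum_self, hzero hnr, hzero hrq, h.sum_of_disjoint hdisj.symm]
    simp
  refine eprFidelity_eq_quarter hpq (isFlatState_cssState hAB).trace_eq_one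
    (hp.trans (cssDecoder_eq p)) (hq.trans (cssDecoder_eq q)) (isQubitPair_res h p)
    (isQubitPair_res h q) ?_ ?_ ?_
  · rw [lift_logX h p, lift_logX h q, pauliString_mul, zero_dotProduct, sgn_zero, one_smul,
      add_zero]
    exact trace_cssState_mul_pauliString hAB (Submodule.zero_mem _) (add_mem_stabZ hreach)
      (by rw [zero_dotProduct, zero_add, hXq])
  · rw [lift_logZ p, lift_logZ q, pauliString_mul, dotProduct_zero, sgn_zero, one_smul, add_zero]
    exact trace_cssState_mul_pauliString hAB (add_mem_stabX hreach) (Submodule.zero_mem _)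
      (by rw [zero_dotProduct, add_zero, hZq])
  · rw [lift_logX h p, lift_logX h q, lift_logZ p, lift_logZ q, pauliString_mul, pauliString_mul,
      smul_mul_smul_comm, pauliString_mul, smul_smul, Matrix.mul_smul, Matrix.trace_smul,
      trace_cssState_mul_pauliString hAB (Submodule.zero_mem _) (add_mem_stabZ hreach), smul_zero]
    rw [zero_dotProduct, zero_add, add_zero, zero_add, hXq]

/-- No pair outside `𝒜` obtains an output close to an EPR pair. -/
theorem eprFidelity_cssState_le_half (h : IsGlobalSolution 𝒜 w) (h𝒜 : PairsDisjoint 𝒜)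
    (hodd : NoOddCycles 𝒜) (htrans : Transitivity 𝒜) {T T' : Finset (Fin n)} (hT : Disjoint T T')
    (hTT' : s(T, T') ∉ 𝒜) {M : DecoderFamily (cssOwner 𝒜)} (hM : IsChannel (M T))
    (hM' : IsChannel (M T')) (hext : ∀ R ∈ flattening 𝒜, M R = cssDecoder w R) :
    eprFidelity (pairOutput (cssOwner 𝒜) (cssState (stabX w) (stabZ 𝒜)) M T T') ≤ 1 / 2 := by
  have hAB := checks_stabX h hodd
  have htr := (isFlatState_cssState hAB).trace_eq_one
  by_cases hTm : T ∈ flattening 𝒜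
  · by_cases hTm' : T' ∈ flattening 𝒜
    · -- By transitivity, disjoint vertices of one component form an authorized pair.
      have hnr : ¬ (authGraph 𝒜).Reachable ⟨T, hTm⟩ ⟨T', hTm'⟩ := by
        rintro ⟨v⟩
        have hv := h.sum_of_walk hodd v
        rw [h.sum_of_disjoint hT] at hv
        have hvodd : ¬ Even v.length := fun he => by
          rw [(ZMod.natCast_eq_zero_iff_even).2 he] at hv
          exact absurd hv (by decide)
        rw [← even_length_bypass_iff hodd, Nat.not_even_iff_odd] at hvodd
        exact hTT' (htrans _ _ v.bypass v.bypass_isPath hvodd hT)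
      refine (eprFidelity_of_not_reachable h h𝒜 hodd (p := ⟨T, hTm⟩) (q := ⟨T', hTm'⟩) hT hnr
        (hext T hTm) (hext T' hTm')).trans_le (by norm_num)
    · obtain ⟨c, α, α', hα, hα', hρ⟩ := exists_product_decomposition hAB T'
        (checks_mask_of_rectangle h T' (h.local_eq T' hTm'))
      refine eprFidelity_pairOutput_le_half hT htr hM hM' c α' α hα' ?_ ?_
      · exact fun k x y hxy => hα k x y fun q hq => hxy q (Finset.disjoint_right.1 hT hq)
      · intro x y
        rw [hρ]
        simp only [mul_comm (α _ _)]
  · obtain ⟨c, α, α', hα, hα', hρ⟩ := exists_product_decomposition hAB T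
      (checks_mask_of_rectangle h T (h.local_eq T hTm))
    exact eprFidelity_pairOutput_le_half hT htr hM hM' c α α'
      (fun k x y hxy => hα k x y fun q hq => hxy q (Finset.disjoint_left.1 hT hq)) hα' hρ

end Sufficiency

end ESS

end

theorem mainTheorem1 (n : ℕ) (S : ESS.PairAccessStructure n)
    (hS : Disjoint S.authorized S.unauthorized) :
    ESS.StabilizerRealizable S ↔
      ESS.NoOddCycles S.authorized ∧
      ESS.Transitivity S.authorized ∧
      ∀ C : (ESS.authGraph S.authorized).ConnectedComponent,
        ∃ u : ESS.flattening S.authorized → ESS.flattening S.authorized → Fin n → ZMod 2,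
          ESS.IsSolution S.authorized C u := by
  classical
  constructor
  · rintro ⟨Q, _, _, owner, ρ, N, hρ, hN, hdist, -, hmax⟩
    by_cases h0 : ρ = 0
    · -- The zero operator yields no EPR pair, so there is no authorized pair.
      have hempty : ∀ T, T ∉ ESS.flattening S.authorized := by
        rintro T ⟨T', hT⟩
        have h := congrFun (congrFun (hdist T T' hT) (0, 0)) (0, 0)
        simp [ESS.pairOutput, ESS.tensorApply, ESS.reducedState, h0, ESS.epr] at h
      refine ⟨fun p => absurd p.2 (hempty _), fun p => absurd p.2 (hempty _), fun C => ?_⟩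
      obtain ⟨p, -⟩ := C.exists_rep
      exact absurd p.2 (hempty _)
    · obtain ⟨h1, h2, u, hu⟩ := ESS.combinatorial_of_realization (hρ.isFlatState h0)
        S.authorized_disjoint hN hdist hmax
      exact ⟨h1, h2, fun C => ⟨u, hu C⟩⟩
  · rintro ⟨hodd, htrans, hsol⟩
    obtain ⟨w, hw⟩ := ESS.exists_isGlobalSolution hsol
    have : Fintype (ESS.flattening S.authorized) := Fintype.ofFinite _
    have hdist : ESS.Distills (ESS.cssOwner S.authorized)
        (ESS.cssState (ESS.stabX w) (ESS.stabZ S.authorized)) (ESS.cssDecoder w) S.authorized :=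
      fun T T' hT => ESS.pairOutput_cssDecoder hw S.authorized_disjoint hodd (p := ⟨T, T', hT⟩)
        (q := ⟨T', T, Sym2.eq_swap ▸ hT⟩) hT
    refine ⟨Fin n × ESS.flattening S.authorized, inferInstance, inferInstance, _, _, _,
      ESS.isStabilizerState_cssState (ESS.checks_stabX hw hodd),
      fun T hT => ESS.isCliffordDecoder_cssDecoder hw ⟨T, hT⟩, hdist, ?_, ?_⟩
    · refine ⟨1 / 2, by norm_num, fun T T' hT M hM hM' hext => ?_⟩
      refine (ESS.eprFidelity_cssState_le_half hw S.authorized_disjoint hodd htrans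
        (S.unauthorized_disjoint _ _ hT) (fun h => Set.disjoint_left.1 hS h hT) hM hM' hext).trans
        (by norm_num)
    · rintro ⟨𝒜', M, hsub, hdisj, hchan, hext, hdist'⟩
      obtain ⟨e, he, he'⟩ := Set.exists_of_ssubset hsub
      induction e using Sym2.ind with
      | _ T T' =>
        have hle := ESS.eprFidelity_cssState_le_half hw S.authorized_disjoint hodd htrans
          (hdisj _ _ he) he' (hchan T ⟨T', he⟩) (hchan T' ⟨T, Sym2.eq_swap ▸ he⟩) hext
        -- The EPR pair itself has fidelity one.
        rw [hdist' T T' he, ESS.eprFidelity_eq] at hle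
        simp only [ESS.sum_zmod_two, ESS.epr, Matrix.of_apply] at hle
        norm_num at hle
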